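/- Let $\mathbb{Z}^2$ be the square lattice with nearest-neighbour edges and $\Lambda_n=\{(x,y)\in\mathbb{Z}^2:\max(|x|,|y|)\le n\}$. For a finite set $S\subset\mathbb{Z}^2$, regarded as the subgraph of $\mathbb{Z}^2$ induced by $S$ with edge set $E(S)$, and for $p\in[0,1]$, $q>0$, let $\phi^0_{S,p,q}$ be the random-cluster measure on $S$ with free boundary conditions, i.e. the probability measure on $\{0,1\}^{E(S)}$ for which $\phi^0_{S,p,q}(\omega)$ is proportional to $q^{k(\omega)}\prod_{e\in E(S)}p^{\omega(e)}(1-p)^{1-\omega(e)}$, where $k(\omega)$ is the number of connected components (isolated vertices included) of the graph with vertex set $S$ and edge set $\{e:\omega(e)=1\}$. Write $0\longleftrightarrow x$ for the event that $0$ and $x$ lie in the same component of that graph. Let $\Delta S=\{(x,y): x\in S,\ y\in\mathbb{Z}^2\setminus S,\ x \text{ and } y \text{ adjacent in } \mathbb{Z}^2\}$ be the edge boundary of $S$ in $\mathbb{Z}^2$, and put $$\varphi_{p,q}(S)=\sum_{(x,y)\in\Delta S}\phi^0_{S,p,q}[0\longleftrightarrow x],\qquad p_{sd}=p_{sd}(q)=\frac{\sqrt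 q}{1+\sqrt q}.$$ Then for every real $q\in[1,3]$ there exists $C>0$ such that for all $n\ge1$ and every $S$ with $0\in S\subset\Lambda_n$, $$\varphi_{p_{sd},q}(S)>C.$$ -/

import Mathlib

namespace RandomCluster

open Finset

noncomputable section

/-- Number of clusters of the configuration `ω` (the set of open edges) on the finite vertex set
`V`: connected components, isolated vertices included, of the graph formed by the open edges.
No wiring is imposed: these are free boundary conditions. -/
def numClusters {V : Type*} (ω : Finset (Sym2 V)) : ℕ :=
  Nat.card (SimpleGraph.fromEdgeSet (ω : Set (Sym2 V))).ConnectedComponent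

open scoped Classical in
/-- The unnormalised free random-cluster weight `q ^ k(ω) * ∏ₑ p ^ ω(e) * (1 - p) ^ (1 - ω(e))`
on the finite graph `G`. A configuration is encoded by its set `ω ⊆ E(G)` of open edges. -/
def weight {V : Type*} [Fintype V] (G : SimpleGraph V) (p q : ℝ) (ω : Finset (Sym2 V)) : ℝ :=
  q ^ numClusters ω * ∏ e ∈ G.edgeFinset, if e ∈ ω then p else 1 - p

open scoped Classical in
/-- The partition function of the free random-cluster model on the finite graph `G`. -/
def partitionFunction {V : Type*} [Fintype V] (G : SimpleGraph V) (p q : ℝ) : ℝ :=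
  ∑ ω ∈ G.edgeFinset.powerset, weight G p q ω

open scoped Classical in
/-- The probability `φ⁰_{G,p,q}[A]` of an event `A` under the free random-cluster measure. -/
def freeProb {V : Type*} [Fintype V] (G : SimpleGraph V) (p q : ℝ)
    (A : Set (Finset (Sym2 V))) : ℝ :=
  (∑ ω ∈ G.edgeFinset.powerset with ω ∈ A, weight G p q ω) / partitionFunction G p q

/-- The square lattice: the nearest-neighbour graph on `ℤ × ℤ`. -/
def squareLattice : SimpleGraph (ℤ × ℤ) where
  Adj u v := |u.1 - v.1| + |u.2 - v.2| = 1
  symm := ⟨fun u v h => by rw [abs_sub_comm v.1, abs_sub_comm v.2]; exact h⟩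
  loopless := ⟨fun u h => by simp at h⟩

/-- The box `Λ_n` of the points `(x, y)` of `ℤ × ℤ` with `max (|x|, |y|) ≤ n`. -/
def box (n : ℕ) : Finset (ℤ × ℤ) :=
  Icc (-(n : ℤ)) n ×ˢ Icc (-(n : ℤ)) n

/-- The finite subgraph of the square lattice induced by the finite set of vertices `S`. -/
abbrev domain (S : Finset (ℤ × ℤ)) : SimpleGraph {x // x ∈ S} :=
  squareLattice.comap Subtype.val

/-- The event that the points `u` and `v` of `S` are joined by a path of open edges of `S`. -/
def connected (S : Finset (ℤ × ℤ)) (u v : ℤ × ℤ) : Set (Finset (Sym2 {x // x ∈ S})) :=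
  {ω | ∃ (hu : u ∈ S) (hv : v ∈ S),
    (SimpleGraph.fromEdgeSet (ω : Set (Sym2 {x // x ∈ S}))).Reachable ⟨u, hu⟩ ⟨v, hv⟩}

/-- The four nearest neighbours of a vertex of the square lattice. -/
def neighbors (x : ℤ × ℤ) : Finset (ℤ × ℤ) :=
  {(x.1 + 1, x.2), (x.1 - 1, x.2), (x.1, x.2 + 1), (x.1, x.2 - 1)}

theorem mem_neighbors {x y : ℤ × ℤ} : y ∈ neighbors x ↔ squareLattice.Adj x y := by
  obtain ⟨a, b⟩ := x
  obtain ⟨c, d⟩ := y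
  simp only [neighbors, squareLattice, mem_insert, mem_singleton, Prod.mk.injEq]
  constructor
  · rintro (⟨rfl, rfl⟩ | ⟨rfl, rfl⟩ | ⟨rfl, rfl⟩ | ⟨rfl, rfl⟩) <;> simp
  · intro h
    rcases abs_cases (a - c) with ⟨h1, _⟩ | ⟨h1, _⟩ <;>
      rcases abs_cases (b - d) with ⟨h2, _⟩ | ⟨h2, _⟩ <;> omega

open scoped Classical in
/-- The edge boundary `ΔS` in the square lattice: all pairs `(x, y)` of adjacent vertices with
`x ∈ S` and `y ∉ S`, see `mem_edgeBoundary`. -/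
def edgeBoundary (S : Finset (ℤ × ℤ)) : Finset ((ℤ × ℤ) × (ℤ × ℤ)) :=
  {e ∈ S ×ˢ S.biUnion neighbors | squareLattice.Adj e.1 e.2 ∧ e.2 ∉ S}

theorem mem_edgeBoundary {S : Finset (ℤ × ℤ)} {x y : ℤ × ℤ} :
    (x, y) ∈ edgeBoundary S ↔ squareLattice.Adj x y ∧ x ∈ S ∧ y ∉ S := by
  simp only [edgeBoundary, mem_filter, mem_product, mem_biUnion]
  constructor
  · rintro ⟨⟨hx, _⟩, h, hy⟩
    exact ⟨h, hx, hy⟩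
  · rintro ⟨h, hx, hy⟩
    exact ⟨⟨hx, x, hx, mem_neighbors.2 h⟩, h, hy⟩

/-- `φ_{p,q}(S) = ∑_{(x,y) ∈ ΔS} φ⁰_{S,p,q}[0 ↔ x]`. -/
def phi (p q : ℝ) (S : Finset (ℤ × ℤ)) : ℝ :=
  ∑ e ∈ edgeBoundary S, freeProb (domain S) p q (connected S (0, 0) e.1)

/-- The self-dual point `p_sd(q) = √q / (1 + √q)`. -/
def selfDualPoint (q : ℝ) : ℝ :=
  √q / (1 + √q)

end

end RandomCluster

namespace RandomCluster

open Finset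

/-! The constant is $C=1$. Close all edges of $S$ touching the slit $\{(0,y):y<0\}$. For $q\ge1$ the
FKG inequality shows that this only lowers connection probabilities (`sum_weight_le_freeProb_mul`),
so it is enough that, in the slit domain, the expected number of boundary edges connected to $0$
exceeds $1$.

There, follow the loop around the cluster of $0$ from one side of the slit to the other, recording
its turning as an integer label $d$, in quarter turns. A real form of the parafermionic observable
is $g(d)=\sin(a(2d-3))$ with $2\cos 2a=\sqrt q$, so that $g(d+1)+g(d-1)=\sqrt q\,g(d)$. At the
self-dual point, opening an edge multiplies the weight by $\sqrt q$ or $1/\sqrt q$, according to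
whether its ends were already connected. If the loop meets an edge, it does so once in one of its
two states and twice in the other, with labels differing by $2$; the weighted increments of $g$ at
this edge then cancel (`edgeSum_pairing`). Since the label runs from $0$ to $3$, telescoping leaves
only edges that are always closed: the expected sum of $g(d)-g(d+1)$ over them is $g(0)-g(3)=-2\sin
3a$ (`sum_loop_boundary`).

Each of these terms equals $-2\sin a\cos(a(2d-2))\ge-2\sin a$. On edges leading to the slit the
label is $-2$ on the right and $4$ on the left, and the term $-2\sin a\cos 6a$ is nonnegative
because $q\le3$. Only edges of $\Delta S$ connected to $0$ can contribute negatively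
(`sum_closed_ge`), so their expected number is at least $\sin 3a/\sin a=1+\sqrt q>1$.

The planar topology is combinatorial: a discrete Hopf formula determines the labels, and potentials
of flows replace the Jordan curve theorem. -/

/-! ### Discrete angles on the square lattice. -/

/-- The unit vector in direction `d`, counted modulo `4`: east, north, west, south. -/
def dir (d : ℤ) : ℤ × ℤ :=
  if d % 4 = 0 then (1, 0) else if d % 4 = 1 then (0, 1) else if d % 4 = 2 then (-1, 0) else (0, -1)

/-- The quadrant of a nonzero vector of the plane, each quadrant containing its clockwise side. -/
def quadrant (v : ℤ × ℤ) : ℤ :=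
  if 0 < v.1 ∧ 0 ≤ v.2 then 0 else if v.1 ≤ 0 ∧ 0 < v.2 then 1
  else if v.1 < 0 ∧ v.2 ≤ 0 then 2 else 3

/-- The number of quarter turns, counted counterclockwise, made by going from `u` to `v`. -/
def quarterTurns (u v : ℤ × ℤ) : ℤ := (quadrant v - quadrant u + 1) % 4 - 1

/-- Two vectors at distance at most one for the supremum norm. -/
def Near (u v : ℤ × ℤ) : Prop :=
  u.1 - v.1 ≤ 1 ∧ v.1 - u.1 ≤ 1 ∧ u.2 - v.2 ≤ 1 ∧ v.2 - u.2 ≤ 1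

theorem dir_cases (d : ℤ) :
    (d % 4 = 0 ∧ dir d = (1, 0)) ∨ (d % 4 = 1 ∧ dir d = (0, 1)) ∨
      (d % 4 = 2 ∧ dir d = (-1, 0)) ∨ (d % 4 = 3 ∧ dir d = (0, -1)) := by
  unfold dir
  split_ifs <;> simp <;> omega

theorem dir_congr {d e : ℤ} (h : d % 4 = e % 4) : dir d = dir e := by
  simp only [dir, h]

theorem dir_add_two (d : ℤ) : dir (d + 2) = -dir d := by
  rcases dir_cases d with ⟨h, h'⟩ | ⟨h, h'⟩ | ⟨h, h'⟩ | ⟨h, h'⟩ <;>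
    rcases dir_cases (d + 2) with ⟨g, g'⟩ | ⟨g, g'⟩ | ⟨g, g'⟩ | ⟨g, g'⟩ <;>
    first | omega | simp [h', g']

theorem quadrant_cases {v : ℤ × ℤ} (hv : v ≠ 0) :
    (quadrant v = 0 ∧ 0 < v.1 ∧ 0 ≤ v.2) ∨ (quadrant v = 1 ∧ v.1 ≤ 0 ∧ 0 < v.2) ∨
      (quadrant v = 2 ∧ v.1 < 0 ∧ v.2 ≤ 0) ∨ (quadrant v = 3 ∧ 0 ≤ v.1 ∧ v.2 < 0) := by
  have : v.1 ≠ 0 ∨ v.2 ≠ 0 := by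
    by_contra! h
    exact hv (Prod.ext h.1 h.2)
  unfold quadrant
  split_ifs <;> simp <;> omega

/-- Near vectors never lie in opposite quadrants, which excludes the ambiguous value 2. -/
theorem quarterTurns_spec {u v : ℤ × ℤ} (hu : u ≠ 0) (hv : v ≠ 0) (h : Near u v) :
    -1 ≤ quarterTurns u v ∧ quarterTurns u v ≤ 1 ∧
      4 ∣ quarterTurns u v - (quadrant v - quadrant u) := by
  have := h.1
  have := h.2.1
  have := h.2.2.1
  have := h.2.2.2
  unfold quarterTurns
  rcases quadrant_cases hu with hu | hu | hu | hu <;>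
    rcases quadrant_cases hv with hv | hv | hv | hv <;> omega

/-- The two sides agree modulo 4 and, by the bounds on each term, differ by at most 3. -/
theorem quarterTurns_add {u v w : ℤ × ℤ} (hu : u ≠ 0) (hv : v ≠ 0) (hw : w ≠ 0)
    (huv : Near u v) (hvw : Near v w) (huw : Near u w) :
    quarterTurns u v + quarterTurns v w = quarterTurns u w := by
  have := quarterTurns_spec hu hv huv
  have := quarterTurns_spec hv hw hvw
  have := quarterTurns_spec hu hw huw
  omega

theorem dir_near (d : ℤ) (u : ℤ × ℤ) : Near u (u + dir d) ∧ Near (u + dir d) u := by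
  rcases dir_cases d with ⟨-, h⟩ | ⟨-, h⟩ | ⟨-, h⟩ | ⟨-, h⟩ <;> simp [Near, h]

/-- The quarter turns around the sides of a unit square not touching the origin add up to zero. -/
theorem quarterTurns_square {u : ℤ × ℤ} (a b : ℤ) (h0 : u ≠ 0) (ha : u + dir a ≠ 0)
    (hb : u + dir b ≠ 0) (hab : u + dir a + dir b ≠ 0) :
    quarterTurns u (u + dir a) + quarterTurns (u + dir a) (u + dir a + dir b) =
      quarterTurns u (u + dir b) + quarterTurns (u + dir b) (u + dir a + dir b) := by
  -- The degenerate squares, with equal or opposite steps, must be covered: the two directions will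
  -- be those of arbitrary steps of a path.
  by_cases hab' : dir a = dir b
  · rw [hab']
  by_cases hopp : dir a + dir b = 0
  · have h1 : u + dir a + dir b = u := by rw [add_assoc, hopp, add_zero]
    rw [h1, quarterTurns_add h0 ha h0 (dir_near a u).1 (dir_near a u).2 (by simp [Near]),
      quarterTurns_add h0 hb h0 (dir_near b u).1 (dir_near b u).2 (by simp [Near])]
  · have hn : Near u (u + dir a + dir b) := by
      rcases dir_cases a with ⟨-, h⟩ | ⟨-, h⟩ | ⟨-, h⟩ | ⟨-, h⟩ <;>
        rcases dir_cases b with ⟨-, h'⟩ | ⟨-, h'⟩ | ⟨-, h'⟩ | ⟨-, h'⟩ <;>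
        simp [Near, h, h'] at hab' hopp ⊢
    have hc : u + dir a + dir b = u + dir b + dir a := by abel
    rw [quarterTurns_add h0 ha hab (dir_near a u).1 (dir_near b _).1 hn,
      quarterTurns_add h0 hb hab (dir_near b u).1 (hc ▸ (dir_near a _).1) hn]

theorem dir_sub_near (a b : ℤ) (h : dir a + dir b ≠ 0) :
    Near (dir a) (dir a + dir b) ∧ Near (dir a + dir b) (dir b) ∧ Near (dir a) (dir b) := by
  rcases dir_cases a with ⟨-, ha⟩ | ⟨-, ha⟩ | ⟨-, ha⟩ | ⟨-, ha⟩ <;>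
    rcases dir_cases b with ⟨-, hb⟩ | ⟨-, hb⟩ | ⟨-, hb⟩ | ⟨-, hb⟩ <;>
    simp [Near, ha, hb] at h ⊢

theorem dir_ne_zero (d : ℤ) : dir d ≠ 0 := by
  rcases dir_cases d with ⟨-, h⟩ | ⟨-, h⟩ | ⟨-, h⟩ | ⟨-, h⟩ <;> simp [h]

theorem quadrant_dir (d : ℤ) : quadrant (dir d) = d % 4 := by
  rcases dir_cases d with ⟨h', h⟩ | ⟨h', h⟩ | ⟨h', h⟩ | ⟨h', h⟩ <;> simp [h, h', quadrant]

/-- The quarter turns from a step to the next one, seen from the end of a path with these steps. -/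
theorem quarterTurns_turn (a b : ℤ) (h : dir a + dir b ≠ 0) (h1 : -1 ≤ b - a) (h2 : b - a ≤ 1) :
    quarterTurns (dir a) (dir a + dir b) + quarterTurns (dir a + dir b) (dir b) = b - a := by
  obtain ⟨n1, n2, n3⟩ := dir_sub_near a b h
  rw [quarterTurns_add (dir_ne_zero a) h (dir_ne_zero b) n1 n2 n3, quarterTurns, quadrant_dir,
    quadrant_dir]
  omega

/-! ### Hopf's formula and winding numbers. -/

/-- **Hopf's formula** for the total turning of a self-avoiding lattice path `p 0, …, p (n + 1)` with
steps `dir (δ 0), …, dir (δ n)`: it is the sum of the turning of the path as seen from its first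
point and of the turning of its last point as seen from the path. -/
theorem turning_eq_sum_quarterTurns {p : ℕ → ℤ × ℤ} {δ : ℕ → ℤ} (n : ℕ)
    (hp : ∀ k ≤ n, p (k + 1) = p k + dir (δ k))
    (hδ : ∀ k < n, -1 ≤ δ (k + 1) - δ k ∧ δ (k + 1) - δ k ≤ 1)
    (hinj : ∀ i j, i < j → j ≤ n + 1 → p i ≠ p j) :
    δ n - δ 0 = ∑ j ∈ range n, quarterTurns (p (j + 1) - p 0) (p (j + 2) - p 0) +
      ∑ i ∈ range n, quarterTurns (p (n + 1) - p i) (p (n + 1) - p (i + 1)) := by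
  induction n with
  | zero => simp
  | succ n ih =>
    have ih' := ih (fun k hk => hp k (by omega)) (fun k hk => hδ k (by omega))
      (fun i j h1 h2 => hinj i j h1 (by omega))
    -- The secants `p j - p i` form a triangular array whose unit cells carry no turning. Hence the
    -- secants to `p (n + 1)` can be replaced by those to `p (n + 2)` up to a telescoping sum.
    have hcell : ∀ i < n, quarterTurns (p (n + 2) - p i) (p (n + 2) - p (i + 1)) =
        quarterTurns (p (n + 1) - p i) (p (n + 1) - p (i + 1)) +
        (quarterTurns (p (n + 1) - p (i + 1)) (p (n + 2) - p (i + 1)) -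
          quarterTurns (p (n + 1) - p i) (p (n + 2) - p i)) := by
      intro i hi
      have e1 : p (n + 2) - p i = p (n + 1) - p i + dir (δ (n + 1)) := by
        rw [hp (n + 1) le_rfl]; abel
      have e2 : p (n + 1) - p (i + 1) = p (n + 1) - p i + dir (δ i + 2) := by
        rw [hp i (by omega), dir_add_two]; abel
      have e3 : p (n + 2) - p (i + 1) =
          p (n + 1) - p i + dir (δ (n + 1)) + dir (δ i + 2) := by
        have e : p (n + 2) - p (i + 1) = (p (n + 2) - p i) + (p (n + 1) - p (i + 1))
          - (p (n + 1) - p i) := by abel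
        rw [e, e1, e2]; abel
      have := quarterTurns_square (u := p (n + 1) - p i) (δ (n + 1)) (δ i + 2)
        (sub_ne_zero.2 (hinj _ _ (by omega) (by omega)).symm)
        (e1 ▸ sub_ne_zero.2 (hinj _ _ (by omega) (by omega)).symm)
        (e2 ▸ sub_ne_zero.2 (hinj _ _ (by omega) (by omega)).symm)
        (e3 ▸ sub_ne_zero.2 (hinj _ _ (by omega) (by omega)).symm)
      rw [← e1] at this
      rw [show p (n + 2) - p (i + 1) = p (n + 2) - p i + dir (δ i + 2) by rw [e3, e1], e2]
      linarith
    rw [sum_range_succ, sum_range_succ _ n, sum_congr rfl fun i hi => hcell i (mem_range.1 hi),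
      sum_add_distrib, sum_range_sub fun i => quarterTurns (p (n + 1) - p i) (p (n + 2) - p i)]
    have ht := quarterTurns_turn (δ n) (δ (n + 1)) (by
      have := sub_ne_zero.2 (hinj n (n + 2) (by omega) (by omega)).symm
      rwa [show p (n + 2) - p n = dir (δ n) + dir (δ (n + 1)) by
        rw [hp (n + 1) le_rfl, hp n (by omega)]; abel] at this) (hδ n (by omega)).1
        (hδ n (by omega)).2
    rw [show p (n + 1 + 1) - p n = dir (δ n) + dir (δ (n + 1)) by
        rw [hp (n + 1) le_rfl, hp n (by omega)]; abel,
      show p (n + 1 + 1) - p (n + 1) = dir (δ (n + 1)) by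
        rw [hp (n + 1) le_rfl]; abel,
      show p (n + 1) - p n = dir (δ n) by rw [hp n (by omega)]; abel]
    linarith

/-- Exchanges the observer and the observed point, so that the second sum of Hopf's formula can be
read as a winding around the last point. -/
theorem quarterTurns_neg {u v : ℤ × ℤ} (hu : u ≠ 0) (hv : v ≠ 0) :
    quarterTurns (-u) (-v) = quarterTurns u v := by
  have h1 : (-u).1 = -u.1 := rfl
  have h2 : (-u).2 = -u.2 := rfl
  have h3 : (-v).1 = -v.1 := rfl
  have h4 : (-v).2 = -v.2 := rfl
  have hu' := neg_ne_zero.2 hu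
  have hv' := neg_ne_zero.2 hv
  have e1 : (quadrant (-u) - quadrant u) % 4 = 2 := by
    rcases quadrant_cases hu with hu | hu | hu | hu <;>
    rcases quadrant_cases hu' with hu' | hu' | hu' | hu' <;> omega
  have e2 : (quadrant (-v) - quadrant v) % 4 = 2 := by
    rcases quadrant_cases hv with hv | hv | hv | hv <;>
    rcases quadrant_cases hv' with hv' | hv' | hv' | hv' <;> omega
  unfold quarterTurns
  omega

/-- Four times the winding number around `c` of the closed lattice path `p s, …, p (s + l), p s`. -/
def winding (p : ℕ → ℤ × ℤ) (s l : ℕ) (c : ℤ × ℤ) : ℤ :=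
  ∑ j ∈ range l, quarterTurns (p (s + j) - c) (p (s + j + 1) - c) +
    quarterTurns (p (s + l) - c) (p s - c)

/-- Moving the centre changes the turn of each step by a difference between its two ends
(`quarterTurns_square`), and these differences cancel around a closed path. -/
theorem winding_add_dir {p : ℕ → ℤ × ℤ} {δ : ℕ → ℤ} {s l : ℕ} {κ : ℤ} {c : ℤ × ℤ} {a : ℤ}
    (hp : ∀ j < l, p (s + j + 1) = p (s + j) + dir (δ (s + j)))
    (hclose : p s = p (s + l) + dir κ)
    (hc : ∀ j ≤ l, p (s + j) ≠ c) (hc' : ∀ j ≤ l, p (s + j) ≠ c + dir a) :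
    winding p s l (c + dir a) = winding p s l c := by
  have hsq : ∀ {x y : ℤ × ℤ} {b : ℤ}, y = x + dir b → x ≠ c → y ≠ c → x ≠ c + dir a →
      y ≠ c + dir a → quarterTurns (x - (c + dir a)) (y - (c + dir a)) =
        quarterTurns (x - c) (y - c) + (quarterTurns (y - c) (y - (c + dir a)) -
          quarterTurns (x - c) (x - (c + dir a))) := by
    rintro x y b rfl h1 h2 h3 h4
    have e1 : x + dir b - c = x - c + dir b := by abel
    have e2 : x - (c + dir a) = x - c + dir (a + 2) := by rw [dir_add_two]; abel
    have e3 : x + dir b - (c + dir a) = x - c + dir b + dir (a + 2) := by rw [dir_add_two]; abel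
    have := quarterTurns_square (u := x - c) b (a + 2) (sub_ne_zero.2 h1) (e1 ▸ sub_ne_zero.2 h2)
      (e2 ▸ sub_ne_zero.2 h3) (e3 ▸ sub_ne_zero.2 h4)
    rw [e1, e2, e3]
    linarith
  unfold winding
  rw [hsq hclose (hc l le_rfl) (hc 0 (Nat.zero_le _)) (hc' l le_rfl) (hc' 0 (Nat.zero_le _)),
    sum_congr rfl fun j hj => hsq (hp j (mem_range.1 hj)) (hc j (mem_range.1 hj).le)
      (hc (j + 1) (mem_range.1 hj)) (hc' j (mem_range.1 hj).le) (hc' (j + 1) (mem_range.1 hj)),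
    sum_add_distrib]
  have := sum_range_sub (fun j => quarterTurns (p (s + j) - c) (p (s + j) - (c + dir a))) l
  simp only [add_zero, ← add_assoc] at this
  rw [this]
  ring

/-- If the steps of the path as seen from `c` follow a branch `β` of the argument, it has winding
number zero around `c`. -/
theorem winding_eq_zero {p : ℕ → ℤ × ℤ} {s l : ℕ} {c : ℤ × ℤ} (β : ℤ × ℤ → ℤ)
    (hβ : ∀ j < l, quarterTurns (p (s + j) - c) (p (s + j + 1) - c) =
      β (p (s + j + 1) - c) - β (p (s + j) - c))
    (hclose : quarterTurns (p (s + l) - c) (p s - c) = β (p s - c) - β (p (s + l) - c)) :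
    winding p s l c = 0 := by
  have := sum_range_sub (fun j => β (p (s + j) - c)) l
  simp only [add_zero, ← add_assoc] at this
  rw [winding, sum_congr rfl fun j hj => hβ j (mem_range.1 hj), hclose, this]
  ring

/-! ### Turning of a self-avoiding loop in the slit plane. -/

/-- The branch of the argument in the plane slit along the downward vertical axis. -/
def argDown (v : ℤ × ℤ) : ℤ := if quadrant v = 3 then -1 else quadrant v

/-- The branch of the argument in the plane slit along the half-line `{(-1, y) | 0 < y}`. -/
def argLeft (v : ℤ × ℤ) : ℤ :=
  if quadrant v = 0 then 4 else if quadrant v = 1 ∧ v.1 = 0 then 5 else quadrant v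

/-- A unit step can cross the cut only by having an end on the downward axis. -/
theorem quarterTurns_eq_argDown {u : ℤ × ℤ} {a : ℤ} (hu : u ≠ 0) (hv : u + dir a ≠ 0)
    (hu' : u.1 = 0 → 0 < u.2) (hv' : (u + dir a).1 = 0 → 0 < (u + dir a).2) :
    quarterTurns u (u + dir a) = argDown (u + dir a) - argDown u := by
  obtain ⟨n1, n2, n3, n4⟩ := (dir_near a u).1
  have hd : u.1 = (u + dir a).1 ∨ u.2 = (u + dir a).2 := by
    rcases dir_cases a with ⟨-, h⟩ | ⟨-, h⟩ | ⟨-, h⟩ | ⟨-, h⟩ <;> simp [h]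
  unfold argDown quarterTurns
  generalize u + dir a = v at *
  rcases quadrant_cases hu with hu | hu | hu | hu <;>
    rcases quadrant_cases hv with hv | hv | hv | hv <;> rw [hu.1, hv.1] <;> norm_num <;> omega

/-- A closed self-avoiding lattice path which starts at `(1, 0)`, avoids the points below `(0, 0)` and
`(1, 0)`, and turns by at most a quarter turn at each step. -/
structure IsSlitLoop (p : ℕ → ℤ × ℤ) (δ : ℕ → ℤ) (N : ℕ) : Prop where
  start : p 0 = (1, 0)
  step : ∀ k < N, p (k + 1) = p k + dir (δ k)
  turn : ∀ k, k + 1 < N → -1 ≤ δ (k + 1) - δ k ∧ δ (k + 1) - δ k ≤ 1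
  closed : p N = p 0
  inj : ∀ i j, i < j → j < N → p i ≠ p j
  slit : ∀ k ≤ N, (p k).1 = 0 ∨ (p k).1 = 1 → 0 ≤ (p k).2

theorem dir_eq_iff {a b : ℤ} : dir a = dir b ↔ a % 4 = b % 4 := by
  refine ⟨fun h => ?_, dir_congr⟩
  rw [← quadrant_dir, h, quadrant_dir]

namespace IsSlitLoop

variable {p : ℕ → ℤ × ℤ} {δ : ℕ → ℤ} {N : ℕ}

theorem inj' (h : IsSlitLoop p δ N) {i j : ℕ} (hij : i < j) (hj : j ≤ N) (h0 : i = 0 → j < N) :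
    p i ≠ p j := by
  rcases hj.lt_or_eq with hj | rfl
  · exact h.inj i j hij hj
  · rw [h.closed]
    exact (h.inj 0 i (by omega) hij).symm

/-- Seen from $(1,0)$, the rest of the loop meets the vertical axis only above, so `argDown` is a
branch of the argument along the closed arc. -/
theorem winding_zero (h : IsSlitLoop p δ N) {s l : ℕ} {κ : ℤ} (hs : 0 < s) (hl : s + l < N)
    (hclose : p s = p (s + l) + dir κ) : winding p s l (p 0) = 0 := by
  have h0 : ∀ j ≤ l, p (s + j) ≠ p 0 := fun j hj => (h.inj 0 _ (by omega) (by omega)).symm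
  have h1 : ∀ j ≤ l, (p (s + j) - p 0).1 = 0 → 0 < (p (s + j) - p 0).2 := by
    intro j hj hz
    have e1 : (p (s + j)).1 = (p 0).1 := sub_eq_zero.1 hz
    have e2 : (p 0).2 ≤ (p (s + j)).2 := by
      have := h.slit (s + j) (by omega)
      rw [e1, h.start] at this
      simpa [h.start] using this
    rcases e2.lt_or_eq with e2 | e2
    · simpa using e2
    · exact absurd (Prod.ext e1 e2.symm) (h0 j hj)
  have key : ∀ i ≤ l, ∀ j ≤ l, ∀ a, p (s + j) = p (s + i) + dir a →
      quarterTurns (p (s + i) - p 0) (p (s + j) - p 0) =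
        argDown (p (s + j) - p 0) - argDown (p (s + i) - p 0) := by
    intro i hi j hj a ha
    have e : p (s + j) - p 0 = p (s + i) - p 0 + dir a := by rw [ha]; abel
    have t1 := sub_ne_zero.2 (h0 j hj)
    have t2 := h1 j hj
    rw [e] at t1 t2 ⊢
    exact quarterTurns_eq_argDown (sub_ne_zero.2 (h0 i hi)) t1 (h1 i hi) t2
  exact winding_eq_zero argDown
    (fun j hj => key j hj.le (j + 1) hj _ (h.step (s + j) (by omega)))
    (key l le_rfl 0 (Nat.zero_le _) _ hclose)

/-- The initial piece of the loop leads from `p 0` to `p m` without touching the closed arc, and the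
winding number is constant along it. -/
theorem winding_before (h : IsSlitLoop p δ N) {s l : ℕ} {κ : ℤ} (hs : 0 < s) (hl : s + l < N)
    (hclose : p s = p (s + l) + dir κ) {m : ℕ} (hm : m < s) : winding p s l (p m) = 0 := by
  induction m with
  | zero => exact h.winding_zero hs hl hclose
  | succ m ih =>
    rw [h.step m (by omega), winding_add_dir (fun j hj => h.step _ (by omega)) hclose
      (fun j hj => (h.inj _ _ (by omega) (by omega)).symm), ih (by omega)]
    intro j hj
    rw [← h.step m (by omega)]
    exact (h.inj _ _ (by omega) (by omega)).symm

/-- The same transport along the final piece of the loop, run backwards from `p N = p 0`. -/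
theorem winding_after (h : IsSlitLoop p δ N) {s l : ℕ} {κ : ℤ} (hs : 0 < s) (hl : s + l < N)
    (hclose : p s = p (s + l) + dir κ) {m : ℕ} (hm : s + l + m < N) :
    winding p s l (p (N - m)) = 0 := by
  induction m with
  | zero => rw [Nat.sub_zero, h.closed]; exact h.winding_zero hs hl hclose
  | succ m ih =>
    have e : N - m = N - (m + 1) + 1 := by omega
    have e1 := h.step (N - (m + 1)) (by omega)
    rw [← ih (by omega), e, e1]
    refine (winding_add_dir (fun j hj => h.step _ (by omega)) hclose
      (fun j hj => h.inj _ _ (by omega) (by omega)) fun j hj => ?_).symm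
    rw [← e1]
    exact h.inj' (by omega) (by omega) (by omega)

/-- When the loop runs along two opposite sides of a unit square with nothing but itself joining the
two other corners, it makes a half turn in between. -/
theorem half_turn (h : IsSlitLoop p δ N) {m M : ℕ} {e f : ℤ} (hm : m + 1 < M) (hM : M ≤ N)
    (hf : f = e + 1 ∨ f = e - 1) (h1 : p (m + 1) = p m + dir e)
    (h2 : p (M - 1) = p m + dir e + dir f) (h3 : p M = p m + dir f) :
    δ (M - 1) - δ m = 2 * (f - e) := by
  have hdir : dir e ≠ 0 ∧ dir f ≠ 0 ∧ dir e + dir f ≠ 0 ∧ dir e - dir f ≠ 0 := by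
    rcases dir_cases e with ⟨h, h'⟩ | ⟨h, h'⟩ | ⟨h, h'⟩ | ⟨h, h'⟩ <;>
    rcases dir_cases f with ⟨g, g'⟩ | ⟨g, g'⟩ | ⟨g, g'⟩ | ⟨g, g'⟩ <;>
    first | omega | simp [h', g']
  have hmM : ¬ (m = 0 ∧ M = N) := by
    rintro ⟨rfl, rfl⟩
    rw [h.closed] at h3
    exact hdir.2.1 (by simpa using h3)
  obtain ⟨l, rfl⟩ : ∃ l, M = m + 1 + l + 1 := ⟨M - (m + 2), by omega⟩
  simp only [Nat.add_sub_cancel] at h2 ⊢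
  -- Up to terms at the corners of the square, the two sums in Hopf's formula for the arc from `p m`
  -- to `p M` are windings of the closed inner arc around `p m` and `p M`. Both windings vanish.
  have hopf := turning_eq_sum_quarterTurns (p := fun k => p (m + k)) (δ := fun k => δ (m + k))
    (l + 1) (fun k hk => h.step (m + k) (by omega)) (fun k hk => h.turn (m + k) (by omega))
    (fun i j hij hj => h.inj' (by omega) (by omega) (by omega))
  have hclose : p (m + 1) = p (m + 1 + l) + dir (f + 2) := by
    rw [h1, h2, dir_add_two]; abel
  have wa := h.winding_before (m := m) (by omega) (by omega) hclose (by omega)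
  have wb := h.winding_after (m := N - (m + 1 + l + 1)) (by omega) (by omega) hclose (by omega)
  rw [show N - (N - (m + 1 + l + 1)) = m + 1 + l + 1 by omega] at wb
  have idx : ∀ j, m + 1 + j = m + (j + 1) := fun j => by omega
  have wa' : ∑ j ∈ range l, quarterTurns (p (m + 1 + j) - p m) (p (m + 1 + j + 1) - p m) =
      ∑ j ∈ range l, quarterTurns (p (m + (j + 1)) - p m) (p (m + (j + 2)) - p m) :=
    sum_congr rfl fun j _ => by rw [idx]; rfl
  have wb' : ∑ j ∈ range l, quarterTurns (p (m + 1 + j) - p (m + 1 + l + 1))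
        (p (m + 1 + j + 1) - p (m + 1 + l + 1)) =
      ∑ j ∈ range l, quarterTurns (p (m + (l + 2)) - p (m + (j + 1)))
        (p (m + (l + 2)) - p (m + (j + 1 + 1))) := by
    refine sum_congr rfl fun j hj => ?_
    have hj := mem_range.1 hj
    rw [← quarterTurns_neg, neg_sub, neg_sub, idx, idx]
    · rfl
    · exact sub_ne_zero.2 (h.inj' (by omega) (by omega) (by omega))
    · exact sub_ne_zero.2 (h.inj' (by omega) (by omega) (by omega))
  simp only [winding] at wa wb
  rw [wa', h1, h2] at wa
  rw [wb', h1, h2, h3] at wb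
  rw [sum_range_succ, sum_range_succ'] at hopf
  have e1 : p (m + (l + 1)) = p m + dir e + dir f := by rw [← idx]; exact h2
  have e2 : p (m + (l + 2)) = p m + dir f := by rw [← h3]; congr 1; omega
  have e3 : δ (m + (l + 1)) = δ (m + 1 + l) := by rw [idx]
  simp only [add_zero, zero_add] at hopf
  rw [show l + 1 + 1 = l + 2 from rfl, e1, e2, h1, e3] at hopf
  rw [e2] at wb
  -- The leftover corner terms depend only on the square: a finite check.
  have fin : -quarterTurns (dir e + dir f) (dir e) + quarterTurns (dir e + dir f) (dir f) +
      (-quarterTurns (dir e) (dir e - dir f) + quarterTurns (dir f) (dir f - dir e)) =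
        2 * (f - e) := by
    rcases dir_cases e with ⟨h, h'⟩ | ⟨h, h'⟩ | ⟨h, h'⟩ | ⟨h, h'⟩ <;>
    rcases dir_cases f with ⟨g, g'⟩ | ⟨g, g'⟩ | ⟨g, g'⟩ | ⟨g, g'⟩ <;>
    first
      | omega
      | (rw [h', g']; norm_num [quarterTurns, quadrant]; omega)
  have a1 : p m + dir e + dir f - p m = dir e + dir f := by abel
  have a2 : p m + dir e - p m = dir e := by abel
  have a3 : p m + dir f - p m = dir f := by abel
  have a4 : p m + dir e + dir f - (p m + dir f) = dir e := by abel
  have a5 : p m + dir e - (p m + dir f) = dir e - dir f := by abel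
  have a6 : p m + dir f - (p m + dir e) = dir f - dir e := by abel
  rw [a1, a2] at wa
  rw [a4, a5] at wb
  rw [a1, a3, a6] at hopf
  rw [hopf]
  linarith

/-- Both sums of Hopf's formula telescope: the one seen from the start through `argDown`, thanks to
the slit, the other through a branch `β` adapted to the endpoint. -/
theorem turning_eq (h : IsSlitLoop p δ N) {n : ℕ} (hn : n + 1 < N) (h0 : δ 0 = 0 ∨ δ 0 = 1)
    (β : ℤ × ℤ → ℤ)
    (hβ : ∀ i < n, ∀ a, p (n + 1) - p (i + 1) = p (n + 1) - p i + dir a →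
      quarterTurns (p (n + 1) - p i) (p (n + 1) - p (i + 1)) =
        β (p (n + 1) - p (i + 1)) - β (p (n + 1) - p i)) :
    δ n = argDown (p (n + 1) - p 0) + β (dir (δ n)) - β (p (n + 1) - p 0) := by
  have hopf := turning_eq_sum_quarterTurns (p := p) (δ := δ)
    n (fun k hk => h.step _ (by omega)) (fun k hk => h.turn _ (by omega))
    (fun i j hij hj => h.inj _ _ (by omega) (by omega))
  have hs : ∀ j < n, quarterTurns (p (j + 1) - p 0) (p (j + 2) - p 0) =
      argDown (p (j + 2) - p 0) - argDown (p (j + 1) - p 0) := by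
    intro j hj
    have hpos : ∀ i, 0 < i → i < N → (p i - p 0).1 = 0 → 0 < (p i - p 0).2 := by
      intro i hi hiN hz
      have e1 : (p i).1 = 1 := by rw [h.start] at hz; simpa [sub_eq_zero] using hz
      have e2 := h.slit i hiN.le (.inr e1)
      have e3 : p i ≠ p 0 := (h.inj 0 i hi hiN).symm
      rw [h.start] at e3 ⊢
      have : (p i).2 ≠ 0 := fun e => e3 (Prod.ext e1 e)
      change 0 < (p i).2 - 0
      omega
    have e : p (j + 2) - p 0 = p (j + 1) - p 0 + dir (δ (j + 1)) := by
      rw [h.step (j + 1) (by omega)]; abel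
    have t1 := sub_ne_zero.2 (h.inj 0 (j + 2) (by omega) (by omega)).symm
    have t2 := hpos (j + 2) (by omega) (by omega)
    rw [e] at t1 t2 ⊢
    exact quarterTurns_eq_argDown (sub_ne_zero.2 (h.inj 0 (j + 1) (by omega) (by omega)).symm) t1
      (hpos (j + 1) (by omega) (by omega)) t2
  rw [sum_congr rfl fun j hj => hs j (mem_range.1 hj),
    sum_range_sub fun j => argDown (p (j + 1) - p 0),
    sum_congr rfl fun i hi => hβ i (mem_range.1 hi) (δ i + 2) (by
      rw [h.step i (by have := mem_range.1 hi; omega), dir_add_two]; abel),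
    sum_range_sub fun i => β (p (n + 1) - p i), zero_add, h.step 0 (by omega),
    h.step n (by omega), add_sub_cancel_left, add_sub_cancel_left] at hopf
  have : argDown (dir (δ 0)) = δ 0 := by
    rcases h0 with h0 | h0 <;> simp [h0, dir, argDown, quadrant]
  rw [h.step n (by omega)]
  linarith

/-- The turning at the first point of the loop on the right side of the half-line. -/
theorem turning_right (h : IsSlitLoop p δ N) {n : ℕ} (hn : n + 1 < N) (h0 : δ 0 = 0 ∨ δ 0 = 1)
    {y : ℤ} (hy : y < 0) (hp : p (n + 1) = (2, y)) (hd : dir (δ n) = (0, -1)) : δ n = -1 := by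
  -- This branch is cut between columns 0 and 1 of the upper half-plane. A secant in column 1 starts
  -- at a loop point of abscissa 1, hence of height at least 0, so it points downwards and the cut
  -- is never crossed.
  let β : ℤ × ℤ → ℤ := fun v => if quadrant v = 0 then 4 else quadrant v
  have hex : ∀ i ≤ n, (p (n + 1) - p i).1 = 1 → (p (n + 1) - p i).2 < 1 := by
    intro i hi h1
    rw [hp] at h1 ⊢
    have e : (p i).1 = 1 := by change 2 - (p i).1 = 1 at h1; omega
    have := h.slit i (by omega) (.inr e)
    change y - (p i).2 < 1
    omega
  have key := h.turning_eq hn h0 β ?_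
  · rw [hd, hp, h.start] at key
    have e1 : ((2, y) : ℤ × ℤ) - (1, 0) = (1, y) := by simp
    have e2 : quadrant (1, y) = 3 := by simp [quadrant]; omega
    have e3 : quadrant (0, -1) = 3 := by simp [quadrant]
    rw [key, e1]
    simp [β, argDown, e2, e3]
  · intro i hi a ha
    have t0 := hex i hi.le
    have t1 := hex (i + 1) hi
    have n0 : p (n + 1) - p i ≠ 0 := sub_ne_zero.2 (h.inj _ _ (by omega) (by omega)).symm
    have n1 : p (n + 1) - p (i + 1) ≠ 0 := sub_ne_zero.2 (h.inj _ _ (by omega) (by omega)).symm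
    rw [ha] at t1 n1 ⊢
    generalize p (n + 1) - p i = u at *
    obtain ⟨m1, m2, m3, m4⟩ := (dir_near a u).1
    have hd : u.1 = (u + dir a).1 ∨ u.2 = (u + dir a).2 := by
      rcases dir_cases a with ⟨-, h⟩ | ⟨-, h⟩ | ⟨-, h⟩ | ⟨-, h⟩ <;> simp [h]
    generalize u + dir a = v at *
    simp only [β, quarterTurns]
    rcases quadrant_cases n0 with hu | hu | hu | hu <;>
      rcases quadrant_cases n1 with hv | hv | hv | hv <;> rw [hu.1, hv.1] <;> norm_num <;> omega

/-- Serves both the left side of the slit and the end of the loop: in each case the secants avoid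
the half-line where `argLeft` is cut. -/
theorem turning_left_aux (h : IsSlitLoop p δ N) {n : ℕ} (hn : n + 1 < N) (h0 : δ 0 = 0 ∨ δ 0 = 1)
    (hex : ∀ i ≤ n, (p (n + 1) - p i).1 = -1 → (p (n + 1) - p i).2 < 1) :
    δ n = argDown (p (n + 1) - p 0) + argLeft (dir (δ n)) - argLeft (p (n + 1) - p 0) := by
  refine h.turning_eq hn h0 argLeft ?_
  intro i hi a ha
  have t0 := hex i hi.le
  have t1 := hex (i + 1) hi
  have n0 : p (n + 1) - p i ≠ 0 := sub_ne_zero.2 (h.inj _ _ (by omega) (by omega)).symm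
  have n1 : p (n + 1) - p (i + 1) ≠ 0 := sub_ne_zero.2 (h.inj _ _ (by omega) (by omega)).symm
  rw [ha] at t1 n1 ⊢
  generalize p (n + 1) - p i = u at *
  obtain ⟨m1, m2, m3, m4⟩ := (dir_near a u).1
  have hd : u.1 = (u + dir a).1 ∨ u.2 = (u + dir a).2 := by
    rcases dir_cases a with ⟨-, h⟩ | ⟨-, h⟩ | ⟨-, h⟩ | ⟨-, h⟩ <;> simp [h]
  generalize u + dir a = v at *
  simp only [argLeft, quarterTurns]
  rcases quadrant_cases n0 with hu | hu | hu | hu <;>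
    rcases quadrant_cases n1 with hv | hv | hv | hv <;> rw [hu.1, hv.1] <;> norm_num <;> omega

/-- The turning at a point of the loop on the left side of the half-line. -/
theorem turning_left (h : IsSlitLoop p δ N) {n : ℕ} (hn : n + 1 < N) (h0 : δ 0 = 0 ∨ δ 0 = 1)
    {y : ℤ} (hy : y < 0) (hp : p (n + 1) = (-1, y)) (hd : dir (δ n) = (0, 1)) : δ n = 5 := by
  have key := h.turning_left_aux hn h0 ?_
  · rw [hd, hp, h.start] at key
    have e1 : ((-1, y) : ℤ × ℤ) - (1, 0) = (-2, y) := by simp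
    have e2 : quadrant (-2, y) = 2 := by simp [quadrant]; omega
    have e3 : quadrant (0, 1) = 1 := by simp [quadrant]
    rw [key, e1]
    simp [argLeft, argDown, e2, e3]
  · intro i hi h1
    rw [hp] at h1 ⊢
    have e : (p i).1 = 0 := by change -1 - (p i).1 = -1 at h1; omega
    have := h.slit i (by omega) (.inl e)
    change y - (p i).2 < 1
    omega

/-- The turning at the end of the loop. -/
theorem turning_end (h : IsSlitLoop p δ N) {n : ℕ} (hn : n + 1 < N) (h0 : δ 0 = 0 ∨ δ 0 = 1)
    (hp : p (n + 1) = (0, 0)) : δ n = argLeft (dir (δ n)) := by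
  have key := h.turning_left_aux hn h0 ?_
  · rw [hp, h.start] at key
    have : argDown ((0, 0) - (1, 0)) = argLeft ((0, 0) - (1, 0)) := by
      simp [argLeft, argDown, quadrant]
    linarith
  · intro i hi h1
    rw [hp] at h1 ⊢
    have e : (p i).1 = 1 := by change 0 - (p i).1 = -1 at h1; omega
    have := h.slit i (by omega) (.inr e)
    change 0 - (p i).2 < 1
    omega

end IsSlitLoop

/-! ### The loop around the cluster of the origin. -/

/-- The edge from the vertex `c.1` in the direction `c.2`. -/
def edgeAt (c : (ℤ × ℤ) × ℤ) : Sym2 (ℤ × ℤ) := s(c.1, c.1 + dir c.2)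

/-- One step of the loop around the clusters of the configuration `O`, clusters being on the left.
The state `(x, d)` is the corner at `x` just clockwise of direction `d`, which is counted in `ℤ` to
keep track of the total turning. -/
def next (O : Finset (Sym2 (ℤ × ℤ))) (c : (ℤ × ℤ) × ℤ) : (ℤ × ℤ) × ℤ :=
  if edgeAt c ∈ O then (c.1 + dir c.2, c.2 - 1) else (c.1, c.2 + 1)

/-- The direction in which `next` moves the position of a corner. -/
def heading (O : Finset (Sym2 (ℤ × ℤ))) (c : (ℤ × ℤ) × ℤ) : ℤ :=
  if edgeAt c ∈ O then c.2 else c.2 + 1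

/-- The position of a corner on the lattice of mesh `1/2`. -/
def pos (c : (ℤ × ℤ) × ℤ) : ℤ × ℤ :=
  (2 * c.1.1 + if c.2 % 4 = 0 ∨ c.2 % 4 = 1 then 1 else 0,
    2 * c.1.2 + if c.2 % 4 = 1 ∨ c.2 % 4 = 2 then 1 else 0)

theorem pos_eq_iff {c c' : (ℤ × ℤ) × ℤ} : pos c = pos c' ↔ c.1 = c'.1 ∧ c.2 % 4 = c'.2 % 4 := by
  obtain ⟨⟨a, b⟩, d⟩ := c
  obtain ⟨⟨a', b'⟩, d'⟩ := c'
  simp only [pos, Prod.mk.injEq]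
  constructor
  · rintro ⟨h1, h2⟩
    split_ifs at h1 h2 <;> omega
  · rintro ⟨⟨rfl, rfl⟩, h⟩
    simp [h]

theorem pos_add_dir (x : ℤ × ℤ) (d : ℤ) : pos (x, d + 1) = pos (x, d) + dir (d + 1) ∧
    pos (x + dir d, d - 1) = pos (x, d) + dir d := by
  rcases dir_cases d with ⟨h, h'⟩ | ⟨h, h'⟩ | ⟨h, h'⟩ | ⟨h, h'⟩ <;>
  rcases dir_cases (d + 1) with ⟨g, g'⟩ | ⟨g, g'⟩ | ⟨g, g'⟩ | ⟨g, g'⟩ <;>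
  first
    | omega
    | (rcases dir_cases (d - 1) with ⟨k, -⟩ | ⟨k, -⟩ | ⟨k, -⟩ | ⟨k, -⟩ <;>
       first
         | omega
         | (simp only [pos, h, h', g, g', k]; norm_num [Prod.ext_iff]; try ring_nf; try simp))

theorem pos_next (O : Finset (Sym2 (ℤ × ℤ))) (c : (ℤ × ℤ) × ℤ) :
    pos (next O c) = pos c + dir (heading O c) := by
  unfold next heading
  split_ifs
  · exact (pos_add_dir c.1 c.2).2
  · exact (pos_add_dir c.1 c.2).1

theorem heading_next (O : Finset (Sym2 (ℤ × ℤ))) (c : (ℤ × ℤ) × ℤ) :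
    -1 ≤ heading O (next O c) - heading O c ∧ heading O (next O c) - heading O c ≤ 1 := by
  unfold heading
  split_ifs with h1 h2 h2 <;> simp only [next, h2, if_true, if_false] <;> omega

theorem edgeAt_congr {c c' : (ℤ × ℤ) × ℤ} (h : pos c = pos c') : edgeAt c = edgeAt c' := by
  obtain ⟨h1, h2⟩ := pos_eq_iff.1 h
  rw [edgeAt, edgeAt, h1, dir_congr h2]

/-- Corners with the same edge are equal or opposite. -/
theorem edgeAt_eq {c c' : (ℤ × ℤ) × ℤ} (h : edgeAt c = edgeAt c') :
    pos c = pos c' ∨ (c'.1 = c.1 + dir c.2 ∧ c'.2 % 4 = (c.2 + 2) % 4) := by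
  rw [edgeAt, edgeAt, Sym2.eq_iff] at h
  rcases h with ⟨h1, h2⟩ | ⟨h1, h2⟩
  · left
    rw [h1, add_right_inj, dir_eq_iff] at h2
    exact pos_eq_iff.2 ⟨h1, h2⟩
  · right
    refine ⟨h2.symm, ?_⟩
    rw [← dir_eq_iff, dir_add_two, eq_neg_iff_add_eq_zero]
    have := h1
    rw [← h2, add_assoc] at this
    rw [add_comm]
    simpa using this.symm

theorem pos_next_congr (O : Finset (Sym2 (ℤ × ℤ))) {c c' : (ℤ × ℤ) × ℤ} (h : pos c = pos c') :
    pos (next O c) = pos (next O c') := by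
  have he := edgeAt_congr h
  obtain ⟨h1, h2⟩ := pos_eq_iff.1 h
  rw [pos_next, pos_next, h]
  congr 1
  unfold heading
  rw [he]
  apply dir_congr
  split_ifs <;> omega

/-- Reversibility makes orbits periodic rather than just eventually periodic. An open step and a
closed step with the same target would concern the same edge. -/
theorem pos_next_inj (O : Finset (Sym2 (ℤ × ℤ))) {c c' : (ℤ × ℤ) × ℤ}
    (h : pos (next O c) = pos (next O c')) : pos c = pos c' := by
  have key : ∀ {c c' : (ℤ × ℤ) × ℤ}, edgeAt c ∈ O → edgeAt c' ∉ O →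
      pos (next O c) ≠ pos (next O c') := by
    intro c c' h1 h2 h
    rw [next, next, if_pos h1, if_neg h2, pos_eq_iff] at h
    obtain ⟨h3, h4⟩ := h
    simp only at h3 h4
    apply h2
    have : dir c'.2 = -dir c.2 := by rw [← dir_add_two]; exact dir_congr (by omega)
    rw [edgeAt, ← h3, this, add_neg_cancel_right, Sym2.eq_swap]
    exact h1
  by_cases h1 : edgeAt c ∈ O <;> by_cases h2 : edgeAt c' ∈ O
  · rw [next, next, if_pos h1, if_pos h2, pos_eq_iff] at h
    obtain ⟨h3, h4⟩ := h
    simp only at h3 h4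
    have h5 : c.2 % 4 = c'.2 % 4 := by omega
    rw [dir_congr h5, add_left_inj] at h3
    exact pos_eq_iff.2 ⟨h3, h5⟩
  · exact absurd h (key h1 h2)
  · exact absurd h.symm (key h2 h1)
  · rw [next, next, if_neg h1, if_neg h2, pos_eq_iff] at h
    obtain ⟨h3, h4⟩ := h
    simp only at h3 h4
    exact pos_eq_iff.2 ⟨h3, by omega⟩

theorem pos_iterate_congr (O : Finset (Sym2 (ℤ × ℤ))) {c c' : (ℤ × ℤ) × ℤ} (h : pos c = pos c')
    (k : ℕ) : pos ((next O)^[k] c) = pos ((next O)^[k] c') := by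
  induction k with
  | zero => exact h
  | succ k ih =>
    rw [Function.iterate_succ_apply', Function.iterate_succ_apply']
    exact pos_next_congr O ih

theorem pos_iterate_inj (O : Finset (Sym2 (ℤ × ℤ))) {c c' : (ℤ × ℤ) × ℤ} (k : ℕ)
    (h : pos ((next O)^[k] c) = pos ((next O)^[k] c')) : pos c = pos c' := by
  induction k with
  | zero => exact h
  | succ k ih =>
    rw [Function.iterate_succ_apply', Function.iterate_succ_apply'] at h
    exact ih (pos_next_inj O h)

theorem iterate_fst_mem (O : Finset (Sym2 (ℤ × ℤ))) (c : (ℤ × ℤ) × ℤ) (k : ℕ) :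
    ((next O)^[k] c).1 = c.1 ∨ ∃ e ∈ O, ((next O)^[k] c).1 ∈ e := by
  induction k with
  | zero => exact .inl rfl
  | succ k ih =>
    rw [Function.iterate_succ_apply']
    generalize (next O)^[k] c = b at *
    unfold next
    split_ifs with h
    · exact .inr ⟨_, h, Sym2.mem_mk_right _ _⟩
    · exact ih

/-- The loop through a corner is finite. -/
theorem exists_return (O : Finset (Sym2 (ℤ × ℤ))) (c : (ℤ × ℤ) × ℤ) :
    ∃ n, 0 < n ∧ pos ((next O)^[n] c) = pos c := by
  -- The orbit stays on these vertices, so two of its corners coincide; injectivity carries the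
  -- repetition back to the start.
  let V : Finset (ℤ × ℤ) := insert c.1 (O.biUnion Sym2.toFinset)
  have hV : ∀ k, ((next O)^[k] c).1 ∈ V := by
    intro k
    rcases iterate_fst_mem O c k with h | ⟨e, he, h⟩
    · simp [V, h]
    · simp only [V, mem_insert, mem_biUnion]
      exact .inr ⟨e, he, by simpa using h⟩
  let f : ℕ → V × Fin 4 := fun k => (⟨_, hV k⟩, ⟨(((next O)^[k] c).2 % 4).toNat, by omega⟩)
  obtain ⟨i, j, hij, hf⟩ := Finite.exists_ne_map_eq_of_infinite f
  wlog hlt : i < j generalizing i j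
  · exact this j i hij.symm hf.symm (by omega)
  refine ⟨j - i, by omega, pos_iterate_inj O i ?_⟩
  rw [← Function.iterate_add_apply, show i + (j - i) = j by omega, eq_comm, pos_eq_iff]
  simp only [f, Prod.mk.injEq, Subtype.mk.injEq, Fin.mk.injEq] at hf
  exact ⟨hf.1, by omega⟩

/-- The loop around the cluster of the origin, from the corner just after the south edge. -/
def loop (O : Finset (Sym2 (ℤ × ℤ))) (k : ℕ) : (ℤ × ℤ) × ℤ := (next O)^[k] ((0, 0), 0)

open scoped Classical in
/-- The length of the loop around the cluster of the origin. -/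
noncomputable def loopLength (O : Finset (Sym2 (ℤ × ℤ))) : ℕ := Nat.find (exists_return O ((0, 0), 0))

theorem loop_succ (O : Finset (Sym2 (ℤ × ℤ))) (k : ℕ) : loop O (k + 1) = next O (loop O k) :=
  Function.iterate_succ_apply' _ _ _

theorem loop_add (O : Finset (Sym2 (ℤ × ℤ))) (j k : ℕ) :
    loop O (j + k) = (next O)^[j] (loop O k) :=
  Function.iterate_add_apply _ _ _ _

theorem loopLength_pos (O : Finset (Sym2 (ℤ × ℤ))) : 0 < loopLength O :=
  (Nat.find_spec (exists_return O ((0, 0), 0))).1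

theorem loop_loopLength (O : Finset (Sym2 (ℤ × ℤ))) : pos (loop O (loopLength O)) = (1, 0) :=
  (Nat.find_spec (exists_return O ((0, 0), 0))).2

theorem loopLength_le {O : Finset (Sym2 (ℤ × ℤ))} {k : ℕ} (h0 : 0 < k)
    (hk : pos (loop O k) = (1, 0)) : loopLength O ≤ k :=
  Nat.find_min' (exists_return O ((0, 0), 0)) ⟨h0, hk⟩

theorem pos_loop_inj {O : Finset (Sym2 (ℤ × ℤ))} {i j : ℕ} (hij : i < j) (hj : j < loopLength O) :
    pos (loop O i) ≠ pos (loop O j) := by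
  intro h
  have h' : pos ((next O)^[i] (loop O 0)) = pos ((next O)^[i] (loop O (j - i))) := by
    rw [← loop_add, ← loop_add, show i + (j - i) = j by omega]; exact h
  have := loopLength_le (k := j - i) (by omega) (pos_iterate_inj O i h').symm
  omega

theorem exists_pos_loop_eq (O : Finset (Sym2 (ℤ × ℤ))) (k : ℕ) :
    ∃ j < loopLength O, pos (loop O j) = pos (loop O k) := by
  induction k using Nat.strong_induction_on with
  | _ k ih =>
    rcases lt_or_ge k (loopLength O) with h | h
    · exact ⟨k, h, rfl⟩
    · obtain ⟨j, hj, hj'⟩ := ih (k - loopLength O) (by have := loopLength_pos O; omega)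
      refine ⟨j, hj, hj'.trans ?_⟩
      rw [show k = k - loopLength O + loopLength O by omega, loop_add, Nat.add_sub_cancel]
      exact pos_iterate_congr O (c := ((0, 0), 0)) (loop_loopLength O).symm _

theorem loop_reachable (O : Finset (Sym2 (ℤ × ℤ))) (k : ℕ) :
    (SimpleGraph.fromEdgeSet (O : Set (Sym2 (ℤ × ℤ)))).Reachable (0, 0) (loop O k).1 := by
  induction k with
  | zero => exact .rfl
  | succ k ih =>
    rw [loop_succ]
    unfold next
    split_ifs with h
    · refine ih.trans (SimpleGraph.Adj.reachable ?_)
      rw [SimpleGraph.fromEdgeSet_adj]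
      exact ⟨h, by simpa using (dir_ne_zero _)⟩
    · exact ih

/-! ### Exact labels along the slit and at repeated edges. -/

/-- No edge of `O` touches the half-line below the origin. -/
def AvoidsSlit (O : Finset (Sym2 (ℤ × ℤ))) : Prop := ∀ e ∈ O, ∀ y : ℤ, y < 0 → ((0, y) : ℤ × ℤ) ∉ e

theorem AvoidsSlit.loop_fst {O : Finset (Sym2 (ℤ × ℤ))} (hO : AvoidsSlit O) (k : ℕ) :
    (loop O k).1.1 = 0 → 0 ≤ (loop O k).1.2 := by
  intro h
  by_contra! hlt
  have e : (loop O k).1 = (0, (loop O k).1.2) := Prod.ext h rfl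
  rcases iterate_fst_mem O ((0, 0), 0) k with h' | ⟨e', he', h'⟩
  · change (loop O k).1 = (0, 0) at h'
    rw [h'] at hlt
    exact lt_irrefl _ hlt
  · change (loop O k).1 ∈ e' at h'
    rw [e] at h'
    exact hO _ he' _ hlt h'

theorem AvoidsSlit.isSlitLoop {O : Finset (Sym2 (ℤ × ℤ))} (hO : AvoidsSlit O) :
    IsSlitLoop (fun k => pos (loop O k)) (fun k => heading O (loop O k)) (loopLength O) where
  start := rfl
  step k _ := by simp only [loop_succ, pos_next]
  turn k _ := by simp only [loop_succ]; exact heading_next O _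
  closed := loop_loopLength O
  inj _ _ := pos_loop_inj
  slit k _ h := by
    have := hO.loop_fst k
    simp only [pos] at h ⊢
    split_ifs at h ⊢ <;> omega

theorem heading_loop_zero (O : Finset (Sym2 (ℤ × ℤ))) :
    heading O (loop O 0) = 0 ∨ heading O (loop O 0) = 1 := by
  unfold heading
  split_ifs <;> simp [loop]

theorem one_lt_loopLength (O : Finset (Sym2 (ℤ × ℤ))) :
    1 < loopLength O := by
  have h0 := loopLength_pos O
  have h1 := loop_loopLength O
  by_contra! h
  rw [show loopLength O = 0 + 1 by omega, loop_succ, pos_next] at h1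
  exact dir_ne_zero (heading O (loop O 0)) (add_eq_left.1 h1)

/-- An open last step would come from the slit vertex $(0,-1)$, so the loop closes by turning at the
origin across its south edge. The turning formula then gives the label itself, not merely its class
modulo 4. -/
theorem AvoidsSlit.loop_end {O : Finset (Sym2 (ℤ × ℤ))} (hO : AvoidsSlit O) :
    loop O (loopLength O - 1) = ((0, 0), 3) := by
  obtain ⟨n, hn⟩ : ∃ n, loopLength O = n + 2 := ⟨loopLength O - 2, by
    have := one_lt_loopLength O; omega⟩
  have h1 := loop_loopLength O
  rw [hn, loop_succ, show ((1, 0) : ℤ × ℤ) = pos ((0, 0), 0) from rfl, pos_eq_iff] at h1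
  rw [hn, show n + 2 - 1 = n + 1 by omega]
  have hcl : edgeAt (loop O (n + 1)) ∉ O := by
    intro h
    rw [next, if_pos h] at h1
    have h2 : dir (loop O (n + 1)).2 = (0, 1) := by
      rw [show ((0, 1) : ℤ × ℤ) = dir 1 from rfl]
      exact dir_congr (by have := h1.2; simp only at this; omega)
    have h3 : (loop O (n + 1)).1 = (0, -1) := by
      have := h1.1
      simp only [h2] at this
      rw [eq_sub_of_add_eq this]; rfl
    exact hO _ h (-1) (by norm_num) (by rw [edgeAt, h3]; exact Sym2.mem_mk_left _ _)
  rw [next, if_neg hcl] at h1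
  simp only at h1
  have hp : pos (loop O (n + 1)) = (0, 0) := by
    rw [show ((0, 0) : ℤ × ℤ) = pos ((0, 0), 3) from rfl, pos_eq_iff]
    exact ⟨h1.1, by omega⟩
  have key := hO.isSlitLoop.turning_end (n := n) (by omega) (heading_loop_zero O) hp
  refine Prod.ext h1.1 ?_
  have h4 : (loop O (n + 1)).2 % 4 = 3 := by omega
  rw [loop_succ] at h4 ⊢
  revert key h4
  simp only [next, heading]
  split_ifs with h
  · intro key h4
    simp only at h4
    rw [show dir (loop O n).2 = (1, 0) from dir_congr (e := 0) (by omega)] at key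
    simp only [argLeft, quadrant] at key ⊢
    norm_num at key
    omega
  · intro key h4
    simp only at h4
    rw [show dir ((loop O n).2 + 1) = (0, -1) from dir_congr (e := 3) (by omega)] at key
    simp only [argLeft, quadrant] at key ⊢
    norm_num at key
    omega

/-- The edge to the slit is closed, so the loop goes on southwards with turning $-1$, one more than
the label. -/
theorem AvoidsSlit.loop_right {O : Finset (Sym2 (ℤ × ℤ))} (hO : AvoidsSlit O) {k : ℕ} {y : ℤ}
    (hk : k < loopLength O) (hy : y < 0) (h1 : (loop O k).1 = (1, y)) (h2 : (loop O k).2 % 4 = 2) :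
    (loop O k).2 = -2 := by
  have hcl : edgeAt (loop O k) ∉ O := by
    intro h
    refine hO _ h y hy ?_
    rw [edgeAt, h1, show dir (loop O k).2 = (-1, 0) from dir_congr (e := 2) (by omega)]
    simp
  have hp : pos (loop O (k + 1)) = (2, 2 * y) := by
    rw [loop_succ, next, if_neg hcl, h1]
    simp only [pos]
    rw [if_neg (by omega), if_neg (by omega)]
    norm_num
  have hk' : k + 1 < loopLength O := by
    refine lt_of_le_of_ne hk fun h => ?_
    have := loop_loopLength O
    rw [← h, hp] at this
    simp at this
  have key := hO.isSlitLoop.turning_right (n := k) hk' (heading_loop_zero O) (y := 2 * y)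
    (by omega) hp (by
      simp only [heading, hcl, if_false]
      exact dir_congr (e := 3) (by omega))
  simp only [heading, hcl, if_false] at key
  omega

/-- Here the loop goes on northwards with turning $5$, again one more than the label. -/
theorem AvoidsSlit.loop_left {O : Finset (Sym2 (ℤ × ℤ))} (hO : AvoidsSlit O) {k : ℕ} {y : ℤ}
    (hk : k < loopLength O) (hy : y < 0) (h1 : (loop O k).1 = (-1, y)) (h2 : (loop O k).2 % 4 = 0) :
    (loop O k).2 = 4 := by
  have hcl : edgeAt (loop O k) ∉ O := by
    intro h
    refine hO _ h y hy ?_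
    rw [edgeAt, h1, show dir (loop O k).2 = (1, 0) from dir_congr (e := 0) (by omega)]
    simp
  have hp : pos (loop O (k + 1)) = (-1, 2 * y + 1) := by
    rw [loop_succ, next, if_neg hcl, h1]
    simp only [pos]
    rw [if_pos (by omega), if_pos (by omega)]
    norm_num
  have hk' : k + 1 < loopLength O := by
    refine lt_of_le_of_ne hk fun h => ?_
    have := loop_loopLength O
    rw [← h, hp] at this
    simp at this
  have key := hO.isSlitLoop.turning_left (n := k) hk' (heading_loop_zero O) (y := 2 * y + 1)
    (by omega) hp (by
      simp only [heading, hcl, if_false]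
      exact dir_congr (e := 1) (by omega))
  simp only [heading, hcl, if_false] at key
  omega

/-- The turning of the loop between its two visits to the same edge. -/
theorem AvoidsSlit.loop_opposite {O : Finset (Sym2 (ℤ × ℤ))} (hO : AvoidsSlit O) {m n : ℕ}
    (hmn : m < n) (hn : n < loopLength O) (he : edgeAt (loop O m) = edgeAt (loop O n)) :
    (loop O n).1 = (loop O m).1 + dir (loop O m).2 ∧
      (loop O n).2 = (loop O m).2 + if edgeAt (loop O m) ∈ O then 2 else -2 := by
  obtain h | ⟨h1, h2⟩ := edgeAt_eq he
  · exact absurd h (pos_loop_inj hmn hn)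
  refine ⟨h1, ?_⟩
  set x := (loop O m).1 with hx
  set w := (loop O m).2 with hw
  have hm : pos (loop O m) = pos (x, w) := rfl
  have hpn : pos (loop O n) = pos (x, w) + dir w + dir (w + 1) := by
    have e1 := (pos_add_dir x w).2
    have e2 := (pos_add_dir (x + dir w) (w - 1)).1
    have e3 := (pos_add_dir (x + dir w) w).1
    have e4 := (pos_add_dir (x + dir w) (w + 1)).1
    have e5 : pos (loop O n) = pos (x + dir w, w + 1 + 1) :=
      pos_eq_iff.2 ⟨h1, by rw [h2]; ring_nf⟩
    rw [e5, e4, e3]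
    rw [sub_add_cancel] at e2
    rw [e2, e1, show w + 1 + 1 = w + 2 by ring, dir_add_two]
    abel
  have hheading : heading O (loop O n) % 4 = (heading O (loop O m) + 2) % 4 := by
    unfold heading
    rw [← he]
    split_ifs <;> omega
  have hlast : pos (loop O (n + 1)) = pos (loop O n) - dir (heading O (loop O m)) := by
    rw [loop_succ, pos_next, dir_congr hheading, dir_add_two]; abel
  -- The four corners beside the edge form a unit square of the half-mesh lattice. The loop runs
  -- along the sides parallel to the edge if it is open and along the other two if it is closed,
  -- hence opposite half turns.
  by_cases ho : edgeAt (loop O m) ∈ O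
  · have hh : heading O (loop O m) = w := by simp [heading, ho, hw]
    have hh' : heading O (loop O n) = (loop O n).2 := by simp [heading, ← he, ho]
    have key := hO.isSlitLoop.half_turn (m := m) (M := n + 1) (e := w) (f := w + 1) (by omega) hn
      (.inl rfl) (by rw [loop_succ, pos_next, hh]) hpn (by
        rw [hlast, hh, hpn, hm]; abel)
    simp only [Nat.add_sub_cancel, hh, hh'] at key
    simp only [ho, if_true]
    omega
  · have hh : heading O (loop O m) = w + 1 := by simp [heading, ho, hw]
    have hh' : heading O (loop O n) = (loop O n).2 + 1 := by simp [heading, ← he, ho]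
    have key := hO.isSlitLoop.half_turn (m := m) (M := n + 1) (e := w + 1) (f := w) (by omega) hn
      (.inr (by ring)) (by rw [loop_succ, pos_next, hh]) (by
        simp only [Nat.add_sub_cancel, hpn, hm]; abel) (by
        rw [hlast, hh, hpn, hm]; abel)
    simp only [Nat.add_sub_cancel, hh, hh'] at key
    simp only [ho, if_false]
    omega

/-! ### Flows, face potentials and separation by cycles. -/

/-- All elements of `O` are edges of the square lattice. -/
def IsLattice (O : Finset (Sym2 (ℤ × ℤ))) : Prop := ∀ e ∈ O, ∃ c, e = edgeAt c

/-- The divergence at `a` of a flow on the square lattice. -/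
def divergence (F : ℤ × ℤ → ℤ × ℤ → ℤ) (a : ℤ × ℤ) : ℤ :=
  F a (a + (1, 0)) + F a (a + (0, 1)) + F a (a + (-1, 0)) + F a (a + (0, -1))

/-- The unit flow along the oriented edge from `u` to `w`. -/
def dartFlow (u w a b : ℤ × ℤ) : ℤ :=
  (if a = u ∧ b = w then 1 else 0) - if a = w ∧ b = u then 1 else 0

theorem divergence_dartFlow (u : ℤ × ℤ) (d : ℤ) (a : ℤ × ℤ) :
    divergence (dartFlow u (u + dir d)) a =
      (if a = u then 1 else 0) - if a = u + dir d then 1 else 0 := by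
  by_cases h1 : a = u
  · subst h1
    rcases dir_cases d with ⟨-, h⟩ | ⟨-, h⟩ | ⟨-, h⟩ | ⟨-, h⟩ <;>
      simp [divergence, dartFlow, h]
  · by_cases h2 : a = u + dir d
    · subst h2
      rcases dir_cases d with ⟨-, h⟩ | ⟨-, h⟩ | ⟨-, h⟩ | ⟨-, h⟩ <;>
        simp [divergence, dartFlow, h, add_assoc]
    · simp [divergence, dartFlow, h1, h2]

/-- Two vertices joined by a path of edges of `O` are the source and the sink of a flow on `O`. -/
theorem exists_flow {O : Finset (Sym2 (ℤ × ℤ))} (hO : IsLattice O) {u v : ℤ × ℤ}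
    (h : (SimpleGraph.fromEdgeSet (O : Set (Sym2 (ℤ × ℤ)))).Reachable u v) :
    ∃ F : ℤ × ℤ → ℤ × ℤ → ℤ, (∀ a b, F b a = -F a b) ∧ (∀ a b, F a b ≠ 0 → s(a, b) ∈ O) ∧
      ∀ a, divergence F a = (if a = u then 1 else 0) - if a = v then 1 else 0 := by
  obtain ⟨p⟩ := h
  induction p with
  | nil => exact ⟨fun _ _ => 0, by simp, by simp, by simp [divergence]⟩
  | @cons u w v hadj p ih =>
    obtain ⟨F, h1, h2, h3⟩ := ih
    rw [SimpleGraph.fromEdgeSet_adj] at hadj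
    obtain ⟨d, hd⟩ : ∃ d, w = u + dir d := by
      obtain ⟨c, hc⟩ := hO _ hadj.1
      rw [edgeAt, Sym2.eq_iff] at hc
      rcases hc with ⟨h, h'⟩ | ⟨h, h'⟩
      · exact ⟨c.2, by rw [h, h']⟩
      · exact ⟨c.2 + 2, by rw [h, h', dir_add_two]; abel⟩
    refine ⟨fun a b => F a b + dartFlow u w a b, fun a b => ?_, fun a b hab => ?_, fun a => ?_⟩
    · change F b a + dartFlow u w b a = -(F a b + dartFlow u w a b)
      rw [h1]
      simp only [dartFlow, and_comm (a := b = u), and_comm (a := b = w)]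
      ring
    · by_cases hF : F a b = 0
      · simp only [hF, dartFlow, zero_add] at hab
        by_cases e1 : a = u ∧ b = w
        · rw [e1.1, e1.2]; exact hadj.1
        by_cases e2 : a = w ∧ b = u
        · rw [e2.1, e2.2, Sym2.eq_swap]; exact hadj.1
        simp [e1, e2] at hab
      · exact h2 a b hF
    · have e1 := divergence_dartFlow u d a
      have e2 := h3 a
      rw [← hd] at e1
      simp only [divergence] at *
      linarith

/-- The face of the square lattice, given by its lower left vertex, which contains a corner. -/
def face (c : (ℤ × ℤ) × ℤ) : ℤ × ℤ :=
  (c.1.1 - if c.2 % 4 = 0 ∨ c.2 % 4 = 1 then 0 else 1,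
    c.1.2 - if c.2 % 4 = 1 ∨ c.2 % 4 = 2 then 0 else 1)

/-- A flow with finite support and no divergence is the gradient of a potential on the faces. -/
theorem exists_potential {F : ℤ × ℤ → ℤ × ℤ → ℤ} (hF : ∀ a b, F b a = -F a b)
    (hfin : ∃ M : ℤ, ∀ a b, a.2 ≤ M → F a b = 0) (hdiv : ∀ a, divergence F a = 0) :
    ∃ h : ℤ × ℤ → ℤ, ∀ c, h (face (c.1, c.2 + 1)) - h (face c) = F c.1 (c.1 + dir c.2) := by
  obtain ⟨M, hM⟩ := hfin
  -- The potential of a face is the flow through the horizontal edges below it; nothing flows at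
  -- height `M` or lower.
  let h : ℤ × ℤ → ℤ := fun f => ∑ k ∈ Ioc M f.2, F (f.1, k) (f.1 + 1, k)
  have vert : ∀ i j, h (i, j) - h (i, j - 1) = F (i, j) (i + 1, j) := by
    intro i j
    rcases le_or_gt j M with hj | hj
    · rw [hM _ _ hj]
      simp [h, Ioc_eq_empty_of_le hj, Ioc_eq_empty_of_le (show j - 1 ≤ M by omega)]
    · have : Ioc M j = insert j (Ioc M (j - 1)) := by
        ext k; simp only [mem_Ioc, mem_insert]; omega
      simp only [h]
      rw [this, sum_insert (by simp)]
      ring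
  have horiz : ∀ i j, h (i, j) - h (i - 1, j) = -F (i, j) (i, j + 1) := by
    intro i j
    rcases le_or_gt j M with hj | hj
    · rw [hM _ _ hj]
      simp [h, Ioc_eq_empty_of_le hj]
    · obtain ⟨n, rfl⟩ : ∃ n : ℕ, j = M + n := ⟨(j - M).toNat, by omega⟩
      clear hj
      induction n with
      | zero =>
        rw [hM _ _ (by simp)]
        simp [h]
      | succ n ih =>
        have e1 := vert i (M + (n + 1 : ℕ))
        have e2 := vert (i - 1) (M + (n + 1 : ℕ))
        have e3 := hdiv (i, M + (n + 1 : ℕ))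
        have e4 : M + (n + 1 : ℕ) - 1 = M + n := by push_cast; ring
        have e5 : (M + n) + 1 = M + (n + 1 : ℕ) := by push_cast; ring
        rw [e4] at e1 e2
        rw [e5] at ih
        simp only [divergence, Prod.mk_add_mk, add_zero, ← sub_eq_add_neg, e4] at e3
        rw [sub_add_cancel] at e2
        have e6 := hF (i, M + n) (i, M + (n + 1 : ℕ))
        have e7 := hF (i - 1, M + (n + 1 : ℕ)) (i, M + (n + 1 : ℕ))
        linarith
  refine ⟨h, ?_⟩
  rintro ⟨⟨i, j⟩, d⟩
  have v1 := vert i j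
  have v2 := vert (i - 1) j
  have h1 := horiz i j
  have h2 := horiz i (j - 1)
  rw [sub_add_cancel] at h2 v2
  have f1 := hF (i, j) (i, j - 1)
  have f2 := hF (i, j) (i - 1, j)
  rcases dir_cases d with ⟨h, h'⟩ | ⟨h, h'⟩ | ⟨h, h'⟩ | ⟨h, h'⟩ <;>
    rcases dir_cases (d + 1) with ⟨g, g'⟩ | ⟨g, g'⟩ | ⟨g, g'⟩ | ⟨g, g'⟩ <;>
    first
      | omega
      | (simp only [face, h, g, h']; norm_num [← sub_eq_add_neg]; linarith)

theorem face_add_dir (x : ℤ × ℤ) (d : ℤ) : face (x + dir d, d - 1) = face (x, d) := by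
  rcases dir_cases d with ⟨h, h'⟩ | ⟨h, h'⟩ | ⟨h, h'⟩ | ⟨h, h'⟩ <;>
    rcases dir_cases (d - 1) with ⟨g, g'⟩ | ⟨g, g'⟩ | ⟨g, g'⟩ | ⟨g, g'⟩ <;>
    first
      | omega
      | (simp only [face, h, g, h']; norm_num; try ring)

theorem face_congr {c c' : (ℤ × ℤ) × ℤ} (h : pos c = pos c') : face c = face c' := by
  obtain ⟨h1, h2⟩ := pos_eq_iff.1 h
  simp only [face, h1, h2]

/-- If the two ends of an edge are already connected without it, then no loop runs along both sides
of the edge. -/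
theorem not_same_loop {O : Finset (Sym2 (ℤ × ℤ))} (hO : IsLattice O) {c c' : (ℤ × ℤ) × ℤ}
    (he : edgeAt c ∉ O)
    (hc : (SimpleGraph.fromEdgeSet (O : Set (Sym2 (ℤ × ℤ)))).Reachable c.1 (c.1 + dir c.2))
    (h1 : c'.1 = c.1 + dir c.2) (h2 : c'.2 % 4 = (c.2 + 2) % 4) (n : ℕ) :
    pos ((next (insert (edgeAt c) O))^[n] c) ≠ pos c' := by
  obtain ⟨x, d⟩ := c
  simp only at h1 h2 hc
  obtain ⟨F, F1, F2, F3⟩ := exists_flow hO hc.symm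
  -- The flow returning inside `O`, completed by the new edge, is a circulation.
  let F' : ℤ × ℤ → ℤ × ℤ → ℤ := fun a b => F a b + dartFlow x (x + dir d) a b
  have hF' : ∀ a b, F' a b ≠ 0 → s(a, b) ∈ insert (edgeAt (x, d)) O := by
    intro a b hab
    by_cases hF : F a b = 0
    · simp only [F', hF, dartFlow, zero_add] at hab
      by_cases e1 : a = x ∧ b = x + dir d
      · rw [e1.1, e1.2]; exact mem_insert_self _ _
      by_cases e2 : a = x + dir d ∧ b = x
      · rw [e2.1, e2.2, Sym2.eq_swap]; exact mem_insert_self _ _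
      simp [e1, e2] at hab
    · exact mem_insert_of_mem (F2 a b hF)
  obtain ⟨h, hh⟩ := exists_potential (F := F') (fun a b => by
      simp only [F', F1 a b, dartFlow, and_comm (a := b = x), and_comm (a := b = x + dir d)]
      ring) (by
      let V := (insert (edgeAt (x, d)) O).biUnion Sym2.toFinset
      obtain ⟨M, hM⟩ := (V.image Prod.snd).bddBelow
      refine ⟨M - 1, fun a b hab => ?_⟩
      by_contra hne
      have := hM (a := a.2) (by
        simp only [coe_image, Set.mem_image, mem_coe]
        refine ⟨a, ?_, rfl⟩
        simp only [V, mem_biUnion]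
        exact ⟨_, hF' a b hne, by simp⟩)
      omega) (fun a => by
      have e1 := divergence_dartFlow x d a
      have e2 := F3 a
      simp only [divergence, F'] at *
      linarith)
  -- The loop either stays in a face or crosses a closed edge, through which nothing flows. The
  -- potential is thus constant along it, whereas it jumps by one between the two sides of the new
  -- edge.
  have hnext : ∀ b, h (face (next (insert (edgeAt (x, d)) O) b)) = h (face b) := by
    intro b
    unfold next
    split_ifs with hb
    · rw [face_add_dir]
    · have := hh b
      by_contra hne
      exact hb (hF' _ _ (by rw [← this]; exact sub_ne_zero.2 hne))
  have hiter : ∀ n, h (face ((next (insert (edgeAt (x, d)) O))^[n] (x, d))) = h (face (x, d)) := by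
    intro n
    induction n with
    | zero => rfl
    | succ n ih => rw [Function.iterate_succ_apply', hnext, ih]
  intro hpos
  have e1 := hiter n
  rw [face_congr hpos] at e1
  have e2 : face (x, d + 1) = face c' := by
    have := face_add_dir (x + dir d) (d + 2)
    rw [dir_add_two, add_neg_cancel_right] at this
    rw [show d + 2 - 1 = d + 1 by ring] at this
    rw [this]
    exact face_congr (pos_eq_iff.2 ⟨h1.symm, h2.symm⟩)
  have e3 := hh (x, d)
  simp only at e3
  rw [e2, e1, sub_self] at e3
  have e4 : F x (x + dir d) = 0 := by
    by_contra hne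
    exact he (F2 _ _ hne)
  simp only [F', e4, dartFlow, zero_add] at e3
  simp [dir_ne_zero] at e3

/-! ### Effect of opening an edge, and cancellation. -/

theorem iterate_insert_eq {O : Finset (Sym2 (ℤ × ℤ))} {e : Sym2 (ℤ × ℤ)} {c : (ℤ × ℤ) × ℤ} {k : ℕ}
    (h : ∀ j < k, edgeAt ((next O)^[j] c) ≠ e) : (next (insert e O))^[k] c = (next O)^[k] c := by
  induction k with
  | zero => rfl
  | succ k ih =>
    rw [Function.iterate_succ_apply', Function.iterate_succ_apply', ih fun j hj => h j (by omega)]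
    have := h k (by omega)
    simp only [next, mem_insert, this, false_or]

/-- The contribution of the edge `e` to the sum of the increments of `g` along the loop. -/
noncomputable def edgeSum (g : ℤ → ℝ) (O : Finset (Sym2 (ℤ × ℤ))) (e : Sym2 (ℤ × ℤ)) : ℝ :=
  ∑ k ∈ (range (loopLength O)).filter (fun k => edgeAt (loop O k) = e),
    (g (loop O k).2 - g (loop O (k + 1)).2)

/-- Any two visits have labels differing by the same $\pm2$, which three visits cannot satisfy. -/
theorem AvoidsSlit.not_three_visits {O : Finset (Sym2 (ℤ × ℤ))} (hO : AvoidsSlit O) {a b c : ℕ}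
    (hab : a < b) (hbc : b < c) (hc : c < loopLength O)
    (h1 : edgeAt (loop O a) = edgeAt (loop O b)) (h2 : edgeAt (loop O b) = edgeAt (loop O c)) :
    False := by
  have e1 := (hO.loop_opposite hab (hbc.trans hc) h1).2
  have e2 := (hO.loop_opposite hbc hc h2).2
  have e3 := (hO.loop_opposite (hab.trans hbc) hc (h1.trans h2)).2
  rw [← h1] at e2
  split_ifs at * <;> omega

theorem AvoidsSlit.edgeSum_two {O : Finset (Sym2 (ℤ × ℤ))} (hO : AvoidsSlit O) (g : ℤ → ℝ) {m n : ℕ}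
    {e : Sym2 (ℤ × ℤ)} (hmn : m < n) (hn : n < loopLength O) (hm' : edgeAt (loop O m) = e)
    (hn' : edgeAt (loop O n) = e) :
    edgeSum g O e = (g (loop O m).2 - g (loop O (m + 1)).2) +
      (g (loop O n).2 - g (loop O (n + 1)).2) := by
  have : (range (loopLength O)).filter (fun k => edgeAt (loop O k) = e) = {m, n} := by
    ext k
    simp only [mem_filter, mem_range, mem_insert, mem_singleton]
    constructor
    · rintro ⟨hk, hk'⟩
      by_contra! hne
      rcases lt_or_ge k m with h1 | h1
      · exact hO.not_three_visits h1 hmn hn (hk'.trans hm'.symm) (hm'.trans hn'.symm)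
      · rcases lt_or_ge k n with h2 | h2
        · exact hO.not_three_visits (lt_of_le_of_ne h1 hne.1.symm) h2 hn (hm'.trans hk'.symm)
            (hk'.trans hn'.symm)
        · exact hO.not_three_visits hmn (lt_of_le_of_ne h2 hne.2.symm) hk (hm'.trans hn'.symm)
            (hn'.trans hk'.symm)
    · rintro (rfl | rfl)
      · exact ⟨hmn.trans hn, hm'⟩
      · exact ⟨hn, hn'⟩
  rw [edgeSum, this, sum_pair hmn.ne]

theorem edgeSum_one {O : Finset (Sym2 (ℤ × ℤ))} (g : ℤ → ℝ) {m : ℕ} {e : Sym2 (ℤ × ℤ)}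
    (hm : m < loopLength O) (hm' : edgeAt (loop O m) = e)
    (h : ∀ k < loopLength O, edgeAt (loop O k) = e → k = m) :
    edgeSum g O e = g (loop O m).2 - g (loop O (m + 1)).2 := by
  have : (range (loopLength O)).filter (fun k => edgeAt (loop O k) = e) = {m} := by
    ext k
    simp only [mem_filter, mem_range, mem_singleton]
    constructor
    · exact fun hk => h k hk.1 hk.2
    · rintro rfl
      exact ⟨hm, hm'⟩
  rw [edgeSum, this, sum_singleton]

theorem edgeSum_eq_zero {O : Finset (Sym2 (ℤ × ℤ))} (g : ℤ → ℝ) {e : Sym2 (ℤ × ℤ)}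
    (h : ∀ k < loopLength O, edgeAt (loop O k) ≠ e) : edgeSum g O e = 0 := by
  rw [edgeSum, filter_false_of_mem fun k hk => h k (mem_range.1 hk), sum_empty]

/-- Opening an edge which the loop visits twice cuts off the part of the loop in between. -/
theorem loop_insert_visit_once {O : Finset (Sym2 (ℤ × ℤ))} (hO : AvoidsSlit O)
    {e : Sym2 (ℤ × ℤ)} (hO' : AvoidsSlit (insert e O)) (he : e ∉ O) {m n : ℕ}
    (hmn : m < n) (hn : n < loopLength O) (hm' : edgeAt (loop O m) = e)
    (hn' : edgeAt (loop O n) = e) {k : ℕ} (hk : k < loopLength (insert e O))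
    (hk' : edgeAt (loop (insert e O) k) = e) : k = m := by
  have hagree : ∀ j ≤ m, loop (insert e O) j = loop O j := fun j hj =>
    iterate_insert_eq fun i hi h =>
      hO.not_three_visits (show i < m by omega) hmn hn (h.trans hm'.symm) (hm'.trans hn'.symm)
  by_contra hne
  have hmk : m < k := by
    by_contra! hlt
    refine hO.not_three_visits (lt_of_le_of_ne hlt hne) hmn hn ?_ (hm'.trans hn'.symm)
    rw [← hagree k hlt, hk', hm']
  set B := loop O (m + 1) with hB
  have hB1 : ∀ j, j ≤ n - (m + 1) → (next (insert e O))^[j] B = loop O (j + (m + 1)) := by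
    intro j hj
    rw [loop_add, ← hB]
    refine iterate_insert_eq fun i hi h => ?_
    rw [hB, ← loop_add] at h
    exact hO.not_three_visits (show m < i + (m + 1) by omega) (by omega) hn (hm'.trans h.symm)
      (h.trans hn'.symm)
  have o1 := hO.loop_opposite hmn hn (hm'.trans hn'.symm)
  have o2 := hO'.loop_opposite hmk hk ((hagree m le_rfl ▸ hm').trans hk'.symm)
  rw [hagree m le_rfl] at o2
  have hpk : pos (loop (insert e O) k) = pos (loop O n) := by
    refine pos_eq_iff.2 ⟨o2.1.trans o1.1.symm, ?_⟩
    rw [o1.2, o2.2]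
    split_ifs <;> omega
  have hpB : pos (next (insert e O) (loop O n)) = pos B := by
    rw [hB, loop_succ, next, next, hm', hn', if_pos (mem_insert_self _ _), if_neg he, pos_eq_iff,
      o1.1, o1.2, hm', if_neg he, add_assoc]
    refine ⟨?_, by simp only; omega⟩
    rw [show dir ((loop O m).2 + -2) = dir ((loop O m).2 + 2) from dir_congr (by omega),
      dir_add_two]
    simp
  -- With `e` open, the old arc from `m + 1` to `n` closes up on itself and misses the starting
  -- corner. A second visit would trap the loop there.
  have hcyc : ∀ i, ∃ j, j ≤ n - (m + 1) ∧
      pos ((next (insert e O))^[i] B) = pos (loop O (j + (m + 1))) := by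
    intro i
    induction i with
    | zero => exact ⟨0, Nat.zero_le _, by rw [zero_add, hB]; rfl⟩
    | succ i ih =>
      obtain ⟨j, hj, hj'⟩ := ih
      rw [Function.iterate_succ_apply']
      rcases hj.lt_or_eq with hlt | rfl
      · refine ⟨j + 1, hlt, ?_⟩
        rw [pos_next_congr _ hj', ← hB1 j hj, ← hB1 (j + 1) hlt, Function.iterate_succ_apply']
      · refine ⟨0, Nat.zero_le _, ?_⟩
        rw [pos_next_congr _ hj', show n - (m + 1) + (m + 1) = n by omega, hpB, zero_add]
  obtain ⟨j, hj, hj'⟩ := hcyc (loopLength (insert e O) - (k + 1))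
  have hk1 : pos (loop (insert e O) (k + 1)) = pos B := by
    rw [loop_succ, pos_next_congr _ hpk, hpB]
  have := pos_iterate_congr (insert e O) hk1 (loopLength (insert e O) - (k + 1))
  rw [hj', ← loop_add, show loopLength (insert e O) - (k + 1) + (k + 1) = loopLength (insert e O) by
    omega, loop_loopLength] at this
  exact pos_loop_inj (i := 0) (show 0 < j + (m + 1) by omega) (by omega) this

/-- Opening an edge which the loop visits only once merges it with another loop. -/
theorem loop_insert_visit_twice {O : Finset (Sym2 (ℤ × ℤ))}
    {e : Sym2 (ℤ × ℤ)} (he : e ∉ O) {m : ℕ} (hm : m < loopLength O)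
    (hm' : edgeAt (loop O m) = e) (h1 : ∀ k < loopLength O, edgeAt (loop O k) = e → k = m) :
    ∃ n, m < n ∧ n < loopLength (insert e O) ∧ edgeAt (loop (insert e O) n) = e := by
  have hagree : ∀ j ≤ m, loop (insert e O) j = loop O j := fun j hj =>
    iterate_insert_eq fun i hi h => absurd (h1 i (by omega) h) (by omega)
  set x := (loop O m).1 with hx
  set w := (loop O m).2 with hw
  set D : (ℤ × ℤ) × ℤ := (x + dir w, w - 1) with hD
  have hmD : loop (insert e O) (m + 1) = D := by
    rw [loop_succ, hagree m le_rfl, next, hm', if_pos (mem_insert_self _ _)]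
  -- The opposite corner of `e` lies on another loop of `O`. Once `e` is open, the loop enters that
  -- other loop at `D` and follows it until it reaches `C`.
  set C : (ℤ × ℤ) × ℤ := (x + dir w, w - 2) with hC
  have heC : edgeAt C = e := by
    rw [← hm', edgeAt, edgeAt, hC, ← hx, ← hw]
    simp only
    rw [show dir (w - 2) = dir (w + 2) from dir_congr (by omega), dir_add_two,
      add_neg_cancel_right, Sym2.eq_swap]
  have hnC : next O C = D := by
    rw [next, heC, if_neg he, hC, hD]
    simp only [Prod.mk.injEq, true_and]
    ring
  have hAC : pos (loop O m) ≠ pos C := by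
    intro h
    have := (pos_eq_iff.1 h).2
    simp only [hC, ← hw] at this
    omega
  have hCm : ∀ j, pos (loop O j) ≠ pos C := by
    intro j hj
    obtain ⟨k, hk, hk'⟩ := exists_pos_loop_eq O j
    have := h1 k hk (by rw [edgeAt_congr (hk'.trans hj), heC])
    subst this
    exact hAC (hk'.trans hj)
  have hret := exists_return O D
  classical
  set n := Nat.find hret with hn
  obtain ⟨hn0, hnD⟩ := Nat.find_spec hret
  rw [← hn] at hn0 hnD
  obtain ⟨l, hl⟩ : ∃ l, n = l + 1 := ⟨n - 1, by omega⟩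
  have hlC : pos ((next O)^[l] D) = pos C := by
    refine pos_next_inj O ?_
    rw [← Function.iterate_succ_apply' (next O), Nat.succ_eq_add_one, ← hl, hnD, hnC]
  have hne : ∀ j < l, edgeAt ((next O)^[j] D) ≠ e := by
    intro j hj h
    rcases edgeAt_eq (hm'.trans h.symm) with h' | ⟨h', h''⟩
    · have := pos_iterate_congr O h' (l - j)
      rw [← Function.iterate_add_apply, show l - j + j = l by omega, hlC, ← loop_add] at this
      exact hCm _ this
    · have hjC : pos ((next O)^[j] D) = pos C :=
        pos_eq_iff.2 ⟨h', by rw [h'']; simp only [hC, ← hw]; omega⟩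
      refine Nat.find_min hret (m := j + 1) (by omega) ⟨by omega, ?_⟩
      rw [Function.iterate_succ_apply', pos_next_congr O hjC, hnC]
  have hvis : pos (loop (insert e O) (l + (m + 1))) = pos C := by
    rw [loop_add, hmD, iterate_insert_eq hne, hlC]
  obtain ⟨k, hk, hk'⟩ := exists_pos_loop_eq (insert e O) (l + (m + 1))
  rw [hvis] at hk'
  refine ⟨k, ?_, hk, by rw [edgeAt_congr hk', heC]⟩
  by_contra! hlt
  rw [hagree k hlt] at hk'
  exact hCm k hk'

/-- The contributions of an edge to the sum along the loop cancel between the configurations where it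
is closed and open. -/
theorem edgeSum_pairing {O : Finset (Sym2 (ℤ × ℤ))} {e : Sym2 (ℤ × ℤ)} (hO : AvoidsSlit O)
    (hO' : AvoidsSlit (insert e O)) (hlat : IsLattice O) (he : e ∉ O) {g : ℤ → ℝ} {r W W' : ℝ}
    (hg : ∀ d, g (d + 1) + g (d - 1) = r * g d)
    (hW : ∀ x y, e = s(x, y) →
      ((SimpleGraph.fromEdgeSet (O : Set (Sym2 (ℤ × ℤ)))).Reachable x y → W' = r * W) ∧
      (¬ (SimpleGraph.fromEdgeSet (O : Set (Sym2 (ℤ × ℤ)))).Reachable x y → W = r * W')) :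
    W * edgeSum g O e + W' * edgeSum g (insert e O) e = 0 := by
  have hclosed : ∀ k, edgeAt (loop O k) = e → (loop O (k + 1)).2 = (loop O k).2 + 1 := by
    intro k hk
    rw [loop_succ, next, hk, if_neg he]
  have hopen : ∀ k, edgeAt (loop (insert e O) k) = e →
      (loop (insert e O) (k + 1)).2 = (loop (insert e O) k).2 - 1 := by
    intro k hk
    rw [loop_succ, next, hk, if_pos (mem_insert_self _ _)]
  by_cases hvis : ∃ m, m < loopLength O ∧ edgeAt (loop O m) = e
  · classical
    set m := Nat.find hvis with hmdef
    obtain ⟨hm, hm'⟩ := Nat.find_spec hvis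
    rw [← hmdef] at hm hm'
    have hmin : ∀ k < m, edgeAt (loop O k) ≠ e := fun k hk h =>
      Nat.find_min hvis hk ⟨by omega, h⟩
    have hagree : ∀ j ≤ m, loop (insert e O) j = loop O j := fun j hj =>
      iterate_insert_eq fun i hi h => hmin i (by omega) h
    have hmO : m < loopLength (insert e O) := by
      by_contra! hle
      have h1 := loop_loopLength (insert e O)
      rw [hagree _ hle] at h1
      have := loopLength_le (loopLength_pos (insert e O)) h1
      omega
    have hm'' : edgeAt (loop (insert e O) m) = e := by rw [hagree m le_rfl, hm']
    have hedge : e = s((loop O m).1, (loop O m).1 + dir (loop O m).2) := hm'.symm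
    -- Two visits with `e` closed, labels `w` and `w - 2`, put both ends in the cluster of the
    -- origin, and opening leaves one visit. A single visit becomes two, labels `w` and `w + 2`, and
    -- then the ends were disconnected. Either way the recursion for `g` at two consecutive labels
    -- gives the cancellation.
    by_cases hsec : ∃ n, m < n ∧ n < loopLength O ∧ edgeAt (loop O n) = e
    · obtain ⟨n, hmn, hn, hn'⟩ := hsec
      have o1 := hO.loop_opposite hmn hn (hm'.trans hn'.symm)
      have hr := (hW _ _ hedge).1 (by
        rw [← o1.1]
        exact (loop_reachable O m).symm.trans (loop_reachable O n))
      rw [hO.edgeSum_two g hmn hn hm' hn', edgeSum_one g hmO hm'' fun k hk hk' =>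
        loop_insert_visit_once hO hO' he hmn hn hm' hn' hk hk', hclosed m hm', hclosed n hn',
        hopen m hm'', hagree m le_rfl, o1.2, hm', if_neg he, hr]
      set w := (loop O m).2
      have g1 := hg w
      have g2 := hg (w - 1)
      rw [show w + -2 + 1 = w - 1 by ring, show w + -2 = w - 1 - 1 by ring]
      rw [sub_add_cancel] at g2
      linear_combination W * (g2 - g1)
    · push Not at hsec
      have honly : ∀ k < loopLength O, edgeAt (loop O k) = e → k = m := by
        intro k hk hk'
        rcases lt_trichotomy k m with h | h | h
        · exact absurd hk' (hmin k h)
        · exact h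
        · exact absurd hk' (hsec k h hk)
      obtain ⟨n, hmn, hn, hn'⟩ := loop_insert_visit_twice he hm hm' honly
      have o1 := hO'.loop_opposite hmn hn (hm''.trans hn'.symm)
      rw [hagree m le_rfl, hm', if_pos (mem_insert_self _ _)] at o1
      have hr := (hW _ _ hedge).2 (fun hreach => by
        refine not_same_loop hlat (c := loop O m) (c' := loop (insert e O) n) (hm' ▸ he) hreach
          o1.1 (by rw [o1.2]) (n - m) ?_
        rw [hm', ← hagree m le_rfl, ← loop_add, Nat.sub_add_cancel hmn.le])
      rw [hO'.edgeSum_two g hmn hn hm'' hn', edgeSum_one g hm hm' honly, hclosed m hm',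
        hopen m hm'', hopen n hn', hagree m le_rfl, o1.2, hr]
      set w := (loop O m).2
      have g1 := hg w
      have g2 := hg (w + 1)
      rw [show w + 2 - 1 = w + 1 by ring, show w + 2 = w + 1 + 1 by ring]
      rw [add_sub_cancel_right] at g2
      linear_combination W' * (g2 - g1)
  · push Not at hvis
    have hagree : ∀ j ≤ loopLength O, loop (insert e O) j = loop O j := fun j hj =>
      iterate_insert_eq fun i hi h => hvis i (by omega) h
    have hle : loopLength (insert e O) ≤ loopLength O :=
      loopLength_le (loopLength_pos O) (by rw [hagree _ le_rfl, loop_loopLength])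
    rw [edgeSum_eq_zero g hvis, edgeSum_eq_zero g fun k hk => ?_]
    · ring
    · rw [hagree k (by omega)]
      exact hvis k (by omega)

/-- Along the loop the contributions of the edges of `E` average out, and there only remain those of
the edges which are always closed. -/
theorem sum_loop_boundary {E : Finset (Sym2 (ℤ × ℤ))} (hE : AvoidsSlit E) (hlat : IsLattice E)
    {g : ℤ → ℝ} {r : ℝ} (hg : ∀ d, g (d + 1) + g (d - 1) = r * g d)
    {W : Finset (Sym2 (ℤ × ℤ)) → ℝ}
    (hW : ∀ O ⊆ E, ∀ x y, s(x, y) ∈ E → s(x, y) ∉ O →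
      ((SimpleGraph.fromEdgeSet (O : Set (Sym2 (ℤ × ℤ)))).Reachable x y →
        W (insert s(x, y) O) = r * W O) ∧
      (¬ (SimpleGraph.fromEdgeSet (O : Set (Sym2 (ℤ × ℤ)))).Reachable x y →
        W O = r * W (insert s(x, y) O))) :
    ∑ O ∈ E.powerset, W O * ∑ k ∈ (range (loopLength O - 1)).filter (fun k => edgeAt (loop O k) ∉ E),
      (g (loop O k).2 - g ((loop O k).2 + 1)) = (g 0 - g 3) * ∑ O ∈ E.powerset, W O := by
  have mono : ∀ O ⊆ E, AvoidsSlit O := fun O h e he => hE e (h he)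
  have hsplit : ∀ O ∈ E.powerset,
      ∑ k ∈ (range (loopLength O - 1)).filter (fun k => edgeAt (loop O k) ∉ E),
        (g (loop O k).2 - g ((loop O k).2 + 1)) = g 0 - g 3 - ∑ e ∈ E, edgeSum g O e := by
    intro O hO
    rw [mem_powerset] at hO
    -- Telescoping stops just before the final step, which crosses the south edge of the origin.
    -- That edge is not in `E`, so the sum over edges of `E` is unaffected.
    have hend := (mono O hO).loop_end
    have htel := sum_range_sub' (fun k => g (loop O k).2) (loopLength O - 1)
    rw [hend, ← sum_filter_add_sum_filter_not _ (fun k => edgeAt (loop O k) ∈ E)] at htel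
    have h1 : (range (loopLength O - 1)).filter (fun k => edgeAt (loop O k) ∈ E) =
        (range (loopLength O)).filter (fun k => edgeAt (loop O k) ∈ E) := by
      ext k
      simp only [mem_filter, mem_range, and_congr_left_iff]
      intro hk
      refine ⟨fun h => by omega, fun h => ?_⟩
      by_contra hlt
      have : k = loopLength O - 1 := by omega
      rw [this, hend] at hk
      refine hE _ hk (-1) (by norm_num) ?_
      rw [edgeAt, show dir (((0, 0), 3) : (ℤ × ℤ) × ℤ).2 = (0, -1) from rfl]
      simp
    have h2 : ∑ e ∈ E, edgeSum g O e =
        ∑ k ∈ (range (loopLength O)).filter (fun k => edgeAt (loop O k) ∈ E),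
          (g (loop O k).2 - g (loop O (k + 1)).2) := by
      rw [← sum_fiberwise_of_maps_to (g := fun k => edgeAt (loop O k)) (t := E)
        (fun k hk => (mem_filter.1 hk).2)]
      refine sum_congr rfl fun e he => ?_
      rw [edgeSum, filter_filter]
      refine sum_congr (filter_congr fun k _ => ?_) fun _ _ => rfl
      exact ⟨fun h => ⟨h ▸ he, h⟩, fun h => h.2⟩
    rw [h1, ← h2] at htel
    have h3 : ∑ k ∈ (range (loopLength O - 1)).filter (fun k => edgeAt (loop O k) ∉ E),
        (g (loop O k).2 - g (loop O (k + 1)).2) =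
        ∑ k ∈ (range (loopLength O - 1)).filter (fun k => edgeAt (loop O k) ∉ E),
        (g (loop O k).2 - g ((loop O k).2 + 1)) := by
      refine sum_congr rfl fun k hk => ?_
      rw [loop_succ, next, if_neg fun h => (mem_filter.1 hk).2 (hO h)]
    rw [h3] at htel
    change _ = g 0 - g 3 at htel
    linarith
  have hzero : ∑ O ∈ E.powerset, W O * ∑ e ∈ E, edgeSum g O e = 0 := by
    simp only [mul_sum]
    rw [sum_comm]
    refine sum_eq_zero fun e he => ?_
    -- Configurations are paired according to the state of `e`.
    have hins := insert_erase he
    have hsum := sum_powerset_insert (notMem_erase e E) (fun O => W O * edgeSum g O e)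
    rw [hins, ← sum_add_distrib] at hsum
    rw [hsum]
    refine sum_eq_zero fun O hO => ?_
    have hO := mem_powerset.1 hO
    have hOE : O ⊆ E := hO.trans (erase_subset _ _)
    have heO : e ∉ O := fun h => notMem_erase e E (hO h)
    refine edgeSum_pairing (mono O hOE) (mono _ (insert_subset he hOE)) (fun e' h => hlat e' (hOE h))
      heO hg ?_
    rintro x y rfl
    exact hW O hOE x y he heO
  rw [sum_congr rfl fun O hO => by rw [hsplit O hO, mul_sub], sum_sub_distrib, hzero, sub_zero,
    ← sum_mul, mul_comm]

/-! ### Lower bound for the boundary in the slit domain. -/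

/-- The points below the origin. -/
def OnSlit (x : ℤ × ℤ) : Prop := x.1 = 0 ∧ x.2 < 0

theorem squareLattice_adj_add_dir (x : ℤ × ℤ) (d : ℤ) : squareLattice.Adj x (x + dir d) := by
  rcases dir_cases d with ⟨-, h⟩ | ⟨-, h⟩ | ⟨-, h⟩ | ⟨-, h⟩ <;> simp [squareLattice, h]

open scoped Classical in
/-- The contribution of the closed edges to the sum along the loop is bounded by the number of edges
of the boundary of `S` which are connected to the origin. -/
theorem sum_closed_ge {S : Finset (ℤ × ℤ)} (h0 : (0, 0) ∈ S) {E O : Finset (Sym2 (ℤ × ℤ))}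
    (hlat : IsLattice E) (hE : ∀ c, edgeAt c ∈ E ↔
      (c.1 ∈ S ∧ ¬ OnSlit c.1) ∧ (c.1 + dir c.2 ∈ S ∧ ¬ OnSlit (c.1 + dir c.2)))
    (hO : AvoidsSlit O) (hOE : O ⊆ E) {f : ℤ → ℝ} {b : ℝ} (hf : ∀ d, -b ≤ f d) (hb : 0 ≤ b)
    (hright : 0 ≤ f (-2)) (hleft : 0 ≤ f 4) :
    -b * ((edgeBoundary S).filter fun e =>
      (SimpleGraph.fromEdgeSet (O : Set (Sym2 (ℤ × ℤ)))).Reachable (0, 0) e.1).card ≤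
    ∑ k ∈ (range (loopLength O - 1)).filter (fun k => edgeAt (loop O k) ∉ E), f (loop O k).2 := by
  set T := (range (loopLength O - 1)).filter (fun k => edgeAt (loop O k) ∉ E) with hT
  have hmem : ∀ k, (loop O k).1 ∈ S ∧ ¬ OnSlit (loop O k).1 := by
    intro k
    rcases iterate_fst_mem O ((0, 0), 0) k with h | ⟨e, he, h⟩
    · change (loop O k).1 = (0, 0) at h
      rw [h]
      exact ⟨h0, by simp [OnSlit]⟩
    · change (loop O k).1 ∈ e at h
      obtain ⟨c, rfl⟩ := hlat _ (hOE he)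
      have := (hE c).1 (hOE he)
      rw [edgeAt, Sym2.mem_iff] at h
      rcases h with h | h <;> rw [h]
      · exact this.1
      · exact this.2
  let ends : ℕ → (ℤ × ℤ) × (ℤ × ℤ) := fun k => ((loop O k).1, (loop O k).1 + dir (loop O k).2)
  have hterm : ∀ k ∈ T, (if (ends k).2 ∉ S then -b else 0) ≤ f (loop O k).2 := by
    intro k hk
    rw [hT, mem_filter, mem_range] at hk
    by_cases hS : (ends k).2 ∉ S
    · rw [if_pos hS]
      exact hf _
    · rw [if_neg hS]
      rw [not_not] at hS
      obtain ⟨hx, hxs⟩ := hmem k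
      have hy : OnSlit ((loop O k).1 + dir (loop O k).2) := by
        by_contra hy
        exact hk.2 ((hE _).2 ⟨⟨hx, hxs⟩, hS, hy⟩)
      have hkN : k < loopLength O := by omega
      obtain ⟨hy1, hy2⟩ := hy
      -- Eastward and westward edges to the slit carry the known labels 4 and $-2$. A northward one
      -- would start on the slit, and a southward one belongs to the last corner of the loop, which
      -- is left out.
      rcases dir_cases (loop O k).2 with ⟨h, h'⟩ | ⟨h, h'⟩ | ⟨h, h'⟩ | ⟨h, h'⟩ <;>
        rw [h'] at hy1 hy2 <;> simp only [Prod.fst_add, Prod.snd_add] at hy1 hy2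
      · rw [hO.loop_left hkN (y := (loop O k).1.2) (by omega)
          (Prod.ext (by simp only; omega) rfl) h]
        exact hleft
      · exact absurd ⟨by omega, by omega⟩ hxs
      · rw [hO.loop_right hkN (y := (loop O k).1.2) (by omega)
          (Prod.ext (by simp only; omega) rfl) h]
        exact hright
      · exfalso
        have h1 : (loop O k).1.2 = 0 := by
          have : ¬ (loop O k).1.2 < 0 := fun hlt => hxs ⟨by omega, hlt⟩
          omega
        refine pos_loop_inj (O := O) (i := k) (j := loopLength O - 1) (by omega) (by omega) ?_
        rw [hO.loop_end, pos_eq_iff]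
        exact ⟨Prod.ext (by simp only; omega) h1, h⟩
  refine le_trans ?_ (sum_le_sum hterm)
  rw [← sum_filter, sum_const, nsmul_eq_mul, neg_mul, mul_neg, neg_le_neg_iff, mul_comm]
  refine mul_le_mul_of_nonneg_left ?_ hb
  norm_cast
  -- The loop has distinct corners, so it meets each oriented edge at most once.
  refine card_le_card_of_injOn ends ?_ ?_
  · intro k hk
    simp only [coe_filter, Set.mem_ofPred_eq] at hk ⊢
    exact ⟨mem_edgeBoundary.2 ⟨squareLattice_adj_add_dir _ _, (hmem k).1, hk.2⟩, loop_reachable O k⟩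
  · intro i hi j hj hij
    simp only [coe_filter, Set.mem_ofPred_eq, hT, mem_filter, mem_range] at hi hj
    simp only [ends, Prod.mk.injEq] at hij
    obtain ⟨e1, e2⟩ := hij
    rw [e1, add_right_inj, dir_eq_iff] at e2
    have hpos := pos_eq_iff.2 ⟨e1, e2⟩
    by_contra hne
    rcases lt_or_gt_of_ne hne with h | h
    · exact pos_loop_inj h (by omega) hpos
    · exact pos_loop_inj h (by omega) hpos.symm

/-- The angle `a` with `2 * cos (2 * a) = √q`. -/
theorem exists_angle {q : ℝ} (hq : q ∈ Set.Icc (1 : ℝ) 3) :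
    ∃ a : ℝ, 2 * Real.cos (2 * a) = √q ∧ 0 < Real.sin a ∧ Real.sin a < Real.sin (3 * a) ∧
      Real.cos (6 * a) ≤ 0 := by
  have hpi := Real.pi_pos
  have h1 : 1 ≤ √q := by rw [Real.one_le_sqrt]; exact hq.1
  have h3 : √q ≤ √3 := Real.sqrt_le_sqrt hq.2
  have h3' : √3 < 2 := by rw [Real.sqrt_lt' (by norm_num)]; norm_num
  set t := Real.arccos (√q / 2) with ht
  have hcos : Real.cos t = √q / 2 := Real.cos_arccos (by linarith) (by linarith)
  have hlo : Real.pi / 6 ≤ t := by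
    rw [ht, ← Real.arccos_cos (show 0 ≤ Real.pi / 6 by positivity) (by linarith),
      Real.cos_pi_div_six]
    exact Real.arccos_le_arccos (by linarith)
  have hhi : t ≤ Real.pi / 3 := by
    rw [ht, ← Real.arccos_cos (show 0 ≤ Real.pi / 3 by positivity) (by linarith),
      Real.cos_pi_div_three]
    exact Real.arccos_le_arccos (by linarith)
  have hsin : 0 < Real.sin (t / 2) :=
    Real.sin_pos_of_pos_of_lt_pi (by linarith) (by linarith)
  refine ⟨t / 2, ?_, hsin, ?_, ?_⟩
  · rw [mul_div_cancel₀ t two_ne_zero, hcos]; ring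
  -- With $a=t/2$ this gives $\sin 3a=(1+2\cos 2a)\sin a=(1+\sqrt q)\sin a$.
  · have e1 : Real.cos t = 1 - 2 * Real.sin (t / 2) ^ 2 := by
      rw [show t = 2 * (t / 2) by ring, Real.cos_two_mul, Real.cos_sq']
      ring_nf
    rw [Real.sin_three_mul]
    nlinarith
  -- Here $6a=3t\in[\pi/2,\pi]$; the lower bound is the condition $q\le3$.
  · refine Real.cos_nonpos_of_pi_div_two_le_of_le ?_ ?_ <;> linarith

open scoped Classical in
/-- The expected number of edges of the boundary of `S` connected to the origin is larger than one
when the edges touching the half-line below the origin are closed. -/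
theorem sum_lt_sum_mul_card {q : ℝ} (hq : q ∈ Set.Icc (1 : ℝ) 3) {S : Finset (ℤ × ℤ)}
    (h0 : (0, 0) ∈ S) {E : Finset (Sym2 (ℤ × ℤ))} (hlat : IsLattice E)
    (hE : ∀ c, edgeAt c ∈ E ↔
      (c.1 ∈ S ∧ ¬ OnSlit c.1) ∧ (c.1 + dir c.2 ∈ S ∧ ¬ OnSlit (c.1 + dir c.2)))
    {W : Finset (Sym2 (ℤ × ℤ)) → ℝ} (hpos : ∀ O ⊆ E, 0 < W O)
    (hW : ∀ O ⊆ E, ∀ x y, s(x, y) ∈ E → s(x, y) ∉ O →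
      ((SimpleGraph.fromEdgeSet (O : Set (Sym2 (ℤ × ℤ)))).Reachable x y →
        W (insert s(x, y) O) = √q * W O) ∧
      (¬ (SimpleGraph.fromEdgeSet (O : Set (Sym2 (ℤ × ℤ)))).Reachable x y →
        W O = √q * W (insert s(x, y) O))) :
    ∑ O ∈ E.powerset, W O < ∑ O ∈ E.powerset, W O * ((edgeBoundary S).filter fun e =>
      (SimpleGraph.fromEdgeSet (O : Set (Sym2 (ℤ × ℤ)))).Reachable (0, 0) e.1).card := by
  obtain ⟨a, ha, hs1, hs3, hc⟩ := exists_angle hq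
  have havoid : AvoidsSlit E := by
    intro e he y hy hmem
    obtain ⟨c, rfl⟩ := hlat e he
    have := (hE c).1 he
    rw [edgeAt, Sym2.mem_iff] at hmem
    rcases hmem with h | h <;> rw [← h] at this
    · exact this.1.2 ⟨rfl, hy⟩
    · exact this.2.2 ⟨rfl, hy⟩
  -- The shift makes `g` odd about $3/2$, midway between the first and last labels. Its increments
  -- are then even about $d=1$, so the labels $-2$ and $4$ give the same term.
  let g : ℤ → ℝ := fun d => Real.sin (a * (2 * d - 3))
  have hg : ∀ d, g (d + 1) + g (d - 1) = √q * g d := by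
    intro d
    simp only [g]
    rw [← ha]
    push_cast
    rw [show a * (2 * ((d : ℝ) + 1) - 3) = a * (2 * d - 3) + 2 * a by ring,
      show a * (2 * ((d : ℝ) - 1) - 3) = a * (2 * d - 3) - 2 * a by ring, Real.sin_add,
      Real.sin_sub]
    ring
  have hdiff : ∀ d : ℤ, g d - g (d + 1) = -(2 * Real.sin a * Real.cos (a * (2 * d - 2))) := by
    intro d
    simp only [g]
    push_cast
    rw [show a * (2 * ((d : ℝ) + 1) - 3) = a * (2 * d - 2) + a by ring,
      show a * (2 * (d : ℝ) - 3) = a * (2 * d - 2) - a by ring, Real.sin_add, Real.sin_sub]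
    ring
  have hident := sum_loop_boundary havoid hlat hg hW
  have hg03 : g 0 - g 3 = -(2 * Real.sin (3 * a)) := by
    simp only [g]
    push_cast
    rw [show a * (2 * (0 : ℝ) - 3) = -(3 * a) by ring,
      show a * (2 * (3 : ℝ) - 3) = 3 * a by ring, Real.sin_neg]
    ring
  have hge : ∀ O ∈ E.powerset, W O * (-(2 * Real.sin a) * ((edgeBoundary S).filter fun e =>
      (SimpleGraph.fromEdgeSet (O : Set (Sym2 (ℤ × ℤ)))).Reachable (0, 0) e.1).card) ≤
      W O * ∑ k ∈ (range (loopLength O - 1)).filter (fun k => edgeAt (loop O k) ∉ E),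
        (g (loop O k).2 - g ((loop O k).2 + 1)) := by
    intro O hO
    have hO := mem_powerset.1 hO
    refine mul_le_mul_of_nonneg_left ?_ (hpos O hO).le
    refine sum_closed_ge h0 hlat hE (fun e he => havoid e (hO he)) hO
      (f := fun d => g d - g (d + 1)) (fun d => ?_) (by positivity) ?_ ?_
    · rw [hdiff]
      have := Real.cos_le_one (a * (2 * d - 2))
      nlinarith
    · rw [hdiff, show a * (2 * ((-2 : ℤ) : ℝ) - 2) = -(6 * a) by push_cast; ring, Real.cos_neg]
      nlinarith
    · rw [hdiff, show a * (2 * ((4 : ℤ) : ℝ) - 2) = 6 * a by push_cast; ring]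
      nlinarith
  have hsum := sum_le_sum hge
  rw [hident, hg03] at hsum
  have htot : 0 < ∑ O ∈ E.powerset, W O :=
    sum_pos (fun O hO => hpos O (mem_powerset.1 hO)) ⟨∅, by simp⟩
  rw [sum_congr rfl fun O _ => show W O * (-(2 * Real.sin a) * ((edgeBoundary S).filter fun e =>
      (SimpleGraph.fromEdgeSet (O : Set (Sym2 (ℤ × ℤ)))).Reachable (0, 0) e.1).card) =
      -(2 * Real.sin a) * (W O * ((edgeBoundary S).filter fun e =>
      (SimpleGraph.fromEdgeSet (O : Set (Sym2 (ℤ × ℤ)))).Reachable (0, 0) e.1).card) by ring,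
    ← mul_sum] at hsum
  by_contra! hle
  have := mul_le_mul_of_nonneg_left hle hs1.le
  have := mul_lt_mul_of_pos_right hs3 htot
  linarith

/-! ### Cluster counts, supermodularity and FKG. -/

section Clusters

variable {V : Type*}

/-- Reachability once the edge between `x` and `y` is opened. -/
theorem reachable_insert_iff [DecidableEq V] {ω : Finset (Sym2 V)} {x y a b : V} :
    (SimpleGraph.fromEdgeSet ((insert s(x, y) ω : Finset (Sym2 V)) : Set (Sym2 V))).Reachable a b ↔
      (SimpleGraph.fromEdgeSet (ω : Set (Sym2 V))).Reachable a b ∨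
      ((SimpleGraph.fromEdgeSet (ω : Set (Sym2 V))).Reachable a x ∧
        (SimpleGraph.fromEdgeSet (ω : Set (Sym2 V))).Reachable y b) ∨
      ((SimpleGraph.fromEdgeSet (ω : Set (Sym2 V))).Reachable a y ∧
        (SimpleGraph.fromEdgeSet (ω : Set (Sym2 V))).Reachable x b) := by
  have hle : SimpleGraph.fromEdgeSet (ω : Set (Sym2 V)) ≤
      SimpleGraph.fromEdgeSet ((insert s(x, y) ω : Finset (Sym2 V)) : Set (Sym2 V)) :=
    SimpleGraph.fromEdgeSet_mono (by simp)
  have hxy : (SimpleGraph.fromEdgeSet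
      ((insert s(x, y) ω : Finset (Sym2 V)) : Set (Sym2 V))).Reachable x y := by
    by_cases h : x = y
    · rw [h]
    · exact SimpleGraph.Adj.reachable (by simp [SimpleGraph.fromEdgeSet_adj, h])
  constructor
  · rintro ⟨p⟩
    induction p with
    | nil => exact .inl .rfl
    | @cons a w b hadj p ih =>
      rw [SimpleGraph.fromEdgeSet_adj, mem_coe, mem_insert] at hadj
      obtain ⟨h | h, hne⟩ := hadj
      · rw [Sym2.eq_iff] at h
        rcases h with ⟨rfl, rfl⟩ | ⟨rfl, rfl⟩
        · rcases ih with h | ⟨-, h⟩ | ⟨-, h⟩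
          · exact .inr (.inl ⟨.rfl, h⟩)
          · exact .inr (.inl ⟨.rfl, h⟩)
          · exact .inl h
        · rcases ih with h | ⟨-, h⟩ | ⟨-, h⟩
          · exact .inr (.inr ⟨.rfl, h⟩)
          · exact .inl h
          · exact .inr (.inr ⟨.rfl, h⟩)
      · have haw : (SimpleGraph.fromEdgeSet (ω : Set (Sym2 V))).Reachable a w :=
          SimpleGraph.Adj.reachable (by rw [SimpleGraph.fromEdgeSet_adj]; exact ⟨h, hne⟩)
        rcases ih with h | ⟨h, h'⟩ | ⟨h, h'⟩
        · exact .inl (haw.trans h)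
        · exact .inr (.inl ⟨haw.trans h, h'⟩)
        · exact .inr (.inr ⟨haw.trans h, h'⟩)
  · rintro (h | ⟨h, h'⟩ | ⟨h, h'⟩)
    · exact h.mono hle
    · exact (h.mono hle).trans (hxy.trans (h'.mono hle))
    · exact (h.mono hle).trans (hxy.symm.trans (h'.mono hle))

theorem numClusters_insert_of_reachable [DecidableEq V] {ω : Finset (Sym2 V)} {x y : V}
    (h : (SimpleGraph.fromEdgeSet (ω : Set (Sym2 V))).Reachable x y) :
    numClusters (insert s(x, y) ω) = numClusters ω := by
  have : (SimpleGraph.fromEdgeSet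
      ((insert s(x, y) ω : Finset (Sym2 V)) : Set (Sym2 V))).Reachable =
      (SimpleGraph.fromEdgeSet (ω : Set (Sym2 V))).Reachable := by
    ext a b
    rw [reachable_insert_iff]
    refine ⟨?_, .inl⟩
    rintro (h1 | ⟨h1, h2⟩ | ⟨h1, h2⟩)
    · exact h1
    · exact h1.trans (h.trans h2)
    · exact h1.trans (h.symm.trans h2)
  unfold numClusters SimpleGraph.ConnectedComponent
  rw [this]

/-- The cluster of `y` is absorbed by that of `x`, so the old clusters other than that of `y`
correspond to the new ones. -/
theorem numClusters_insert_of_not_reachable [Finite V] [DecidableEq V] {ω : Finset (Sym2 V)} {x y : V}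
    (h : ¬ (SimpleGraph.fromEdgeSet (ω : Set (Sym2 V))).Reachable x y) :
    numClusters ω = numClusters (insert s(x, y) ω) + 1 := by
  classical
  set G := SimpleGraph.fromEdgeSet (ω : Set (Sym2 V)) with hG
  set G' := SimpleGraph.fromEdgeSet ((insert s(x, y) ω : Finset (Sym2 V)) : Set (Sym2 V)) with hG'
  have hreach : ∀ {a b}, G'.Reachable a b ↔ _ := fun {a b} =>
    reachable_insert_iff (ω := ω) (x := x) (y := y) (a := a) (b := b)
  rw [← hG] at hreach
  have hle : G ≤ G' := SimpleGraph.fromEdgeSet_mono (by simp)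
  have := Fintype.ofFinite G.ConnectedComponent
  let f : {c : G.ConnectedComponent // c ≠ G.connectedComponentMk y} → G'.ConnectedComponent :=
    fun c => c.1.map (SimpleGraph.Hom.ofLE hle)
  have hf : Function.Bijective f := by
    constructor
    · rintro ⟨c, hc⟩ ⟨d, hd⟩ hcd
      induction c using SimpleGraph.ConnectedComponent.ind with | _ a =>
      induction d using SimpleGraph.ConnectedComponent.ind with | _ b =>
      simp only [ne_eq, SimpleGraph.ConnectedComponent.eq] at hc hd
      have hcd' : G'.Reachable a b := SimpleGraph.ConnectedComponent.exact hcd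
      rw [Subtype.mk.injEq, SimpleGraph.ConnectedComponent.eq]
      rcases hreach.1 hcd' with h1 | ⟨h1, h2⟩ | ⟨h1, h2⟩
      · exact h1
      · exact absurd h2.symm hd
      · exact absurd h1 hc
    · intro c
      induction c using SimpleGraph.ConnectedComponent.ind with | _ a =>
      by_cases ha : G.Reachable a y
      · refine ⟨⟨G.connectedComponentMk x, fun h' => h (SimpleGraph.ConnectedComponent.exact h')⟩, ?_⟩
        exact SimpleGraph.ConnectedComponent.sound (hreach.2 (.inr (.inl ⟨.rfl, ha.symm⟩)))
      · exact ⟨⟨G.connectedComponentMk a, fun h' => ha (SimpleGraph.ConnectedComponent.exact h')⟩,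
          rfl⟩
  change Nat.card G.ConnectedComponent = Nat.card G'.ConnectedComponent + 1
  rw [← Nat.card_congr (Equiv.ofBijective f hf), Nat.card_eq_fintype_card, Nat.card_eq_fintype_card,
    Fintype.card_subtype_compl, Fintype.card_subtype_eq]
  have : 0 < Fintype.card G.ConnectedComponent := Fintype.card_pos_iff.2 ⟨G.connectedComponentMk y⟩
  omega

/-- An edge merging two clusters of the larger configuration also merges two of the smaller one. -/
theorem numClusters_insert_add_le [Finite V] [DecidableEq V] {ω η : Finset (Sym2 V)} (h : ω ⊆ η)
    (e : Sym2 V) : numClusters η + numClusters (insert e ω) ≤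
      numClusters ω + numClusters (insert e η) := by
  induction e using Sym2.ind with | _ x y =>
  by_cases h1 : (SimpleGraph.fromEdgeSet (ω : Set (Sym2 V))).Reachable x y
  · have h2 := h1.mono (SimpleGraph.fromEdgeSet_mono (coe_subset.2 h))
    rw [numClusters_insert_of_reachable h1, numClusters_insert_of_reachable h2, add_comm]
  · have := numClusters_insert_of_not_reachable h1
    by_cases h2 : (SimpleGraph.fromEdgeSet (η : Set (Sym2 V))).Reachable x y
    · rw [numClusters_insert_of_reachable h2]; omega
    · have := numClusters_insert_of_not_reachable h2
      omega

theorem numClusters_union_add_le [Finite V] [DecidableEq V] {ω η : Finset (Sym2 V)} (h : ω ⊆ η)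
    (T : Finset (Sym2 V)) : numClusters η + numClusters (ω ∪ T) ≤
      numClusters ω + numClusters (η ∪ T) := by
  induction T using Finset.induction_on with
  | empty => simp [add_comm]
  | insert e T _ ih =>
    have := numClusters_insert_add_le (union_subset_union_left (t := T) h) e
    rw [union_insert, union_insert]
    omega

/-- The number of clusters is supermodular. -/
theorem numClusters_supermodular [Finite V] [DecidableEq V] (ω η : Finset (Sym2 V)) :
    numClusters ω + numClusters η ≤ numClusters (ω ∩ η) + numClusters (ω ∪ η) := by
  have := numClusters_union_add_le (inter_subset_right : ω ∩ η ⊆ η) ω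
  rw [union_eq_right.2 inter_subset_left, union_comm η] at this
  omega

theorem weight_pos [Fintype V] (G : SimpleGraph V) {p q : ℝ} (hp : 0 < p) (hp1 : p < 1) (hq : 0 < q)
    (ω : Finset (Sym2 V)) : 0 < weight G p q ω := by
  unfold weight
  refine mul_pos (pow_pos hq _) (prod_pos fun e _ => ?_)
  split_ifs <;> linarith

-- The FKG lattice condition: the edge factors agree on both sides, and $q\ge1$ converts
-- supermodularity into the inequality.
open scoped Classical in
theorem weight_mul_le [Fintype V] (G : SimpleGraph V) {p q : ℝ} (hp : 0 < p) (hp1 : p < 1)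
    (hq : 1 ≤ q) (ω η : Finset (Sym2 V)) :
    weight G p q ω * weight G p q η ≤ weight G p q (ω ∩ η) * weight G p q (ω ∪ η) := by
  unfold weight
  rw [mul_mul_mul_comm, mul_mul_mul_comm (q ^ numClusters (ω ∩ η)), ← pow_add, ← pow_add, ← prod_mul_distrib,
    ← prod_mul_distrib]
  have : ∀ e ∈ G.edgeFinset, ((if e ∈ ω then p else 1 - p) * if e ∈ η then p else 1 - p) =
      (if e ∈ ω ∩ η then p else 1 - p) * if e ∈ ω ∪ η then p else 1 - p := by
    intro e _
    by_cases h1 : e ∈ ω <;> by_cases h2 : e ∈ η <;> simp [h1, h2, mul_comm]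
  rw [prod_congr rfl this]
  refine mul_le_mul_of_nonneg_right (pow_le_pow_right₀ hq (numClusters_supermodular ω η))
    (prod_nonneg fun e _ => ?_)
  refine mul_nonneg ?_ ?_ <;> split_ifs <;> linarith

open scoped Classical in
/-- Closing edges decreases the probability of an increasing event. -/
theorem sum_weight_le_freeProb_mul [Fintype V] (G : SimpleGraph V) {p q : ℝ} (hp : 0 < p)
    (hp1 : p < 1) (hq : 1 ≤ q) {D : Finset (Sym2 V)} (hD : D ⊆ G.edgeFinset)
    {A : Set (Finset (Sym2 V))} (hA : ∀ ω η, ω ⊆ η → ω ∈ A → η ∈ A) :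
    ∑ ω ∈ D.powerset with ω ∈ A, weight G p q ω ≤
      freeProb G p q A * ∑ ω ∈ D.powerset, weight G p q ω := by
  have hw : ∀ ω, 0 < weight G p q ω := weight_pos G hp hp1 (by linarith)
  -- FKG on the lattice of all finite sets of pairs, with `μ` vanishing off `G`. Closing all edges
  -- outside `D` is a decreasing event, so the indicator `g` of its complement is increasing.
  let μ : Finset (Sym2 V) → ℝ := fun ω => if ω ⊆ G.edgeFinset then weight G p q ω else 0
  let f : Finset (Sym2 V) → ℝ := fun ω => if ω ∈ A then 1 else 0
  let g : Finset (Sym2 V) → ℝ := fun ω => if ω ⊆ D then 0 else 1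
  have key := fkg f g μ (fun ω => by simp only [μ]; split_ifs; exacts [(hw ω).le, le_rfl])
    (fun ω => by simp only [f]; split_ifs <;> simp) (fun ω => by simp only [g]; split_ifs <;> simp)
    (fun ω η h => by
      simp only [f]
      by_cases h1 : ω ∈ A
      · simp [h1, hA ω η h h1]
      · rw [if_neg h1]; split_ifs <;> simp)
    (fun ω η h => by
      simp only [g]
      by_cases h1 : η ⊆ D
      · simp [h1, Finset.Subset.trans h h1]
      · rw [if_neg h1]; split_ifs <;> simp)
    (fun ω η => by
      by_cases h1 : ω ⊆ G.edgeFinset <;> by_cases h2 : η ⊆ G.edgeFinset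
      · have h3 : ω ∩ η ⊆ G.edgeFinset := inter_subset_left.trans h1
        have h4 : ω ∪ η ⊆ G.edgeFinset := union_subset h1 h2
        simp only [μ, inf_eq_inter, sup_eq_union, h1, h2, h3, h4, if_true]
        exact weight_mul_le G hp hp1 hq ω η
      all_goals
        simp only [μ, h1, h2, if_false, zero_mul, mul_zero]
        refine mul_nonneg ?_ ?_ <;> split_ifs <;> first | exact (hw _).le | exact le_rfl)
  set Z := ∑ ω ∈ G.edgeFinset.powerset, weight G p q ω with hZ
  set a := ∑ ω ∈ G.edgeFinset.powerset with ω ∈ A, weight G p q ω with ha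
  set b := ∑ ω ∈ D.powerset, weight G p q ω with hb
  set c := ∑ ω ∈ D.powerset with ω ∈ A, weight G p q ω with hc
  have s1 : ∑ ω, μ ω = Z := by
    rw [hZ, ← sum_filter]
    exact sum_congr (by ext; simp) fun _ _ => rfl
  have s2 : ∑ ω, μ ω * f ω = a := by
    simp only [μ, f, mul_ite, mul_one, mul_zero, ha]
    rw [← sum_filter, ← sum_filter, filter_filter]
    exact sum_congr (by ext; simp [and_comm]) fun _ _ => rfl
  have s3 : ∑ ω, μ ω * g ω = Z - b := by
    have : ∀ ω, μ ω * g ω = μ ω - if ω ⊆ D then μ ω else 0 := by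
      intro ω; simp only [g]; split_ifs <;> ring
    rw [sum_congr rfl fun ω _ => this ω, sum_sub_distrib, s1, ← sum_filter]
    congr 1
    refine sum_congr (by ext; simp) fun ω hω => ?_
    simp only [μ]
    rw [if_pos ((mem_powerset.1 hω).trans hD)]
  have s4 : ∑ ω, μ ω * (f ω * g ω) = a - c := by
    have : ∀ ω, μ ω * (f ω * g ω) = μ ω * f ω - if ω ⊆ D ∧ ω ∈ A then μ ω else 0 := by
      intro ω; simp only [g, f]
      by_cases h1 : ω ⊆ D <;> by_cases h2 : ω ∈ A <;> simp [h1, h2]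
    rw [sum_congr rfl fun ω _ => this ω, sum_sub_distrib, s2, ← sum_filter]
    congr 1
    refine sum_congr (by ext; simp) fun ω hω => ?_
    simp only [μ]
    rw [if_pos ((mem_powerset.1 (mem_filter.1 hω).1).trans hD)]
  rw [s1, s2, s3, s4] at key
  have hZpos : 0 < Z := sum_pos (fun ω _ => hw ω) ⟨∅, by simp⟩
  change c ≤ a / Z * b
  rw [div_mul_eq_mul_div, le_div_iff₀ hZpos]
  linarith

end Clusters

/-! ### Self-dual weights and transfer to the plane. -/

open scoped Classical in
theorem prod_insert_edge {V : Type*} [Fintype V] (G : SimpleGraph V) {p r : ℝ} (hp : p = r * (1 - p))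
    {ω : Finset (Sym2 V)} {e : Sym2 V} (he : e ∈ G.edgeFinset) (heω : e ∉ ω) :
    ∏ e' ∈ G.edgeFinset, (if e' ∈ insert e ω then p else 1 - p) =
      r * ∏ e' ∈ G.edgeFinset, if e' ∈ ω then p else 1 - p := by
  rw [← mul_prod_erase _ _ he, ← mul_prod_erase _ (fun e' => if e' ∈ ω then p else 1 - p) he,
    if_pos (mem_insert_self _ _), if_neg heω, ← mul_assoc, ← hp]
  congr 1
  refine prod_congr rfl fun e' he' => ?_
  simp [ne_of_mem_erase he']

theorem weight_insert_of_reachable {V : Type*} [Fintype V] [DecidableEq V] (G : SimpleGraph V)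
    {p q : ℝ} (hp : p = √q * (1 - p)) {ω : Finset (Sym2 V)} {x y : V}
    (he : G.Adj x y) (heω : s(x, y) ∉ ω)
    (h : (SimpleGraph.fromEdgeSet (ω : Set (Sym2 V))).Reachable x y) :
    weight G p q (insert s(x, y) ω) = √q * weight G p q ω := by
  classical
  have := prod_insert_edge G hp (by simpa using he) heω
  have hk := numClusters_insert_of_reachable h
  unfold weight
  rw [hk]
  have e : ∀ (a b c : ℝ), a = √q * b → c * a = √q * (c * b) := by
    rintro _ _ _ rfl; ring
  apply e
  convert this

/-- The edge brings $p/(1-p)=\sqrt q$ and the lost cluster $1/q$, in all $1/\sqrt q$. -/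
theorem weight_insert_of_not_reachable {V : Type*} [Fintype V] [DecidableEq V] (G : SimpleGraph V)
    {p q : ℝ} (hq : 0 ≤ q) (hp : p = √q * (1 - p)) {ω : Finset (Sym2 V)} {x y : V}
    (he : G.Adj x y) (heω : s(x, y) ∉ ω)
    (h : ¬ (SimpleGraph.fromEdgeSet (ω : Set (Sym2 V))).Reachable x y) :
    weight G p q ω = √q * weight G p q (insert s(x, y) ω) := by
  classical
  have := prod_insert_edge G hp (by simpa using he) heω
  have hk := numClusters_insert_of_not_reachable h
  unfold weight
  rw [hk, pow_succ]
  have e : ∀ (a b c : ℝ), a = √q * b → c * q * b = √q * (c * a) := by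
    rintro _ b c rfl
    nth_rewrite 1 [← Real.mul_self_sqrt hq]
    ring
  apply e
  convert this

/-- The inclusion of the edges between points of `S` into those between points of the plane. -/
def edgeIncl (S : Finset (ℤ × ℤ)) : Sym2 {x // x ∈ S} ↪ Sym2 (ℤ × ℤ) :=
  (Function.Embedding.subtype (· ∈ S)).sym2Map

theorem edgeIncl_mk (S : Finset (ℤ × ℤ)) (u v : {x // x ∈ S}) :
    edgeIncl S s(u, v) = s(u.1, v.1) := rfl

/-- Every open edge has both ends in `S`, so an open path in the plane started in `S` stays there
and lifts. -/
theorem reachable_map_edgeIncl {S : Finset (ℤ × ℤ)} {ω : Finset (Sym2 {x // x ∈ S})}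
    {u v : {x // x ∈ S}} :
    (SimpleGraph.fromEdgeSet ((ω.map (edgeIncl S) : Finset _) : Set (Sym2 (ℤ × ℤ)))).Reachable u.1 v.1
      ↔ (SimpleGraph.fromEdgeSet (ω : Set (Sym2 {x // x ∈ S}))).Reachable u v := by
  constructor
  · have key : ∀ {a b : ℤ × ℤ} (_ : (SimpleGraph.fromEdgeSet
        ((ω.map (edgeIncl S) : Finset _) : Set (Sym2 (ℤ × ℤ)))).Walk a b) (u : {x // x ∈ S}),
        u.1 = a → ∃ v : {x // x ∈ S}, v.1 = b ∧
          (SimpleGraph.fromEdgeSet (ω : Set (Sym2 {x // x ∈ S}))).Reachable u v := by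
      intro a b p
      induction p with
      | nil => exact fun u hu => ⟨u, hu, .rfl⟩
      | @cons a w b hadj p ih =>
        rintro u rfl
        rw [SimpleGraph.fromEdgeSet_adj, mem_coe, mem_map] at hadj
        obtain ⟨⟨e, he, he'⟩, hne⟩ := hadj
        induction e using Sym2.ind with | _ c d =>
        have hw : ∃ w' : {x // x ∈ S}, w'.1 = w ∧ s(u, w') ∈ ω := by
          rw [edgeIncl_mk, Sym2.eq_iff] at he'
          rcases he' with ⟨h1, h2⟩ | ⟨h1, h2⟩
          · exact ⟨d, h2, by rwa [← Subtype.ext h1]⟩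
          · exact ⟨c, h1, by rwa [← Subtype.ext h2, Sym2.eq_swap]⟩
        obtain ⟨w', rfl, hmem⟩ := hw
        obtain ⟨v, hv, hr⟩ := ih w' rfl
        refine ⟨v, hv, SimpleGraph.Reachable.trans (SimpleGraph.Adj.reachable ?_) hr⟩
        rw [SimpleGraph.fromEdgeSet_adj]
        exact ⟨hmem, fun h => hne (by rw [h])⟩
    rintro ⟨p⟩
    obtain ⟨v', hv', hr⟩ := key p u rfl
    rwa [← Subtype.ext hv']
  · rintro ⟨p⟩
    induction p with
    | nil => exact .rfl
    | @cons a w b hadj p ih =>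
      rw [SimpleGraph.fromEdgeSet_adj] at hadj
      refine SimpleGraph.Reachable.trans (SimpleGraph.Adj.reachable ?_) ih
      rw [SimpleGraph.fromEdgeSet_adj, mem_coe, ← edgeIncl_mk]
      exact ⟨mem_map_of_mem _ hadj.1, fun h => hadj.2 (Subtype.ext h)⟩

open scoped Classical in
theorem one_lt_phi {q : ℝ} (hq : q ∈ Set.Icc (1 : ℝ) 3) {S : Finset (ℤ × ℤ)} (h0 : (0, 0) ∈ S) :
    1 < phi (selfDualPoint q) q S := by
  set p := selfDualPoint q with hp
  have hq0 : 0 < q := by linarith [hq.1]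
  have hs : 0 < √q := Real.sqrt_pos.2 hq0
  have hp0 : 0 < p := by rw [hp, selfDualPoint]; positivity
  have hp1 : p < 1 := by rw [hp, selfDualPoint, div_lt_one (by positivity)]; linarith
  have hpq : p = √q * (1 - p) := by rw [hp, selfDualPoint]; field_simp; ring
  set G := domain S
  -- The edges that may be open in the slit domain. Weights keep the factors $1-p$ of the other
  -- edges of `S`, so sums over subsets of `D` describe the free measure conditioned on those being
  -- closed.
  let D : Finset (Sym2 {x // x ∈ S}) := G.edgeFinset.filter fun e => ∀ v ∈ e, ¬ OnSlit v.1
  have hD : D ⊆ G.edgeFinset := filter_subset _ _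
  have hDmem : ∀ u v : {x // x ∈ S}, s(u, v) ∈ D ↔
      squareLattice.Adj u.1 v.1 ∧ ¬ OnSlit u.1 ∧ ¬ OnSlit v.1 := by
    intro u v
    rw [mem_filter, SimpleGraph.mem_edgeFinset, SimpleGraph.mem_edgeSet]
    refine and_congr Iff.rfl ⟨fun h => ⟨h u (Sym2.mem_mk_left _ _), h v (Sym2.mem_mk_right _ _)⟩, ?_⟩
    rintro ⟨h1, h2⟩ w hw
    rcases Sym2.mem_iff.1 hw with rfl | rfl
    exacts [h1, h2]
  let E := D.map (edgeIncl S)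
  have hadj : ∀ x y, squareLattice.Adj x y → ∃ d, y = x + dir d := by
    intro x y hxy
    rw [← mem_neighbors] at hxy
    simp only [neighbors, mem_insert, mem_singleton] at hxy
    rcases hxy with rfl | rfl | rfl | rfl
    · exact ⟨0, by simp [dir, Prod.ext_iff]⟩
    · exact ⟨2, by simp [dir, Prod.ext_iff]; ring⟩
    · exact ⟨1, by simp [dir, Prod.ext_iff]⟩
    · exact ⟨3, by simp [dir, Prod.ext_iff]; ring⟩
  have hEmem : ∀ x y, s(x, y) ∈ E ↔
      (x ∈ S ∧ ¬ OnSlit x) ∧ (y ∈ S ∧ ¬ OnSlit y) ∧ squareLattice.Adj x y := by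
    intro x y
    simp only [E, mem_map]
    constructor
    · rintro ⟨e, he, he'⟩
      induction e using Sym2.ind with | _ u v =>
      obtain ⟨h1, h2, h3⟩ := (hDmem u v).1 he
      rw [edgeIncl_mk, Sym2.eq_iff] at he'
      rcases he' with ⟨rfl, rfl⟩ | ⟨rfl, rfl⟩
      · exact ⟨⟨u.2, h2⟩, ⟨v.2, h3⟩, h1⟩
      · exact ⟨⟨v.2, h3⟩, ⟨u.2, h2⟩, h1.symm⟩
    · rintro ⟨⟨h1, h2⟩, ⟨h3, h4⟩, h5⟩
      exact ⟨s(⟨x, h1⟩, ⟨y, h3⟩), (hDmem _ _).2 ⟨h5, h2, h4⟩, rfl⟩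
  have hlat : IsLattice E := by
    intro e he
    induction e using Sym2.ind with | _ x y =>
    obtain ⟨d, rfl⟩ := hadj x y ((hEmem x y).1 he).2.2
    exact ⟨(x, d), rfl⟩
  have hE : ∀ c, edgeAt c ∈ E ↔
      (c.1 ∈ S ∧ ¬ OnSlit c.1) ∧ (c.1 + dir c.2 ∈ S ∧ ¬ OnSlit (c.1 + dir c.2)) := by
    intro c
    rw [edgeAt, hEmem]
    exact ⟨fun h => ⟨h.1, h.2.1⟩, fun h => ⟨h.1, h.2, squareLattice_adj_add_dir _ _⟩⟩
  let W : Finset (Sym2 (ℤ × ℤ)) → ℝ := fun O =>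
    weight G p q (O.preimage (edgeIncl S) (edgeIncl S).injective.injOn)
  have hWmap : ∀ ω : Finset (Sym2 {x // x ∈ S}), W (ω.map (edgeIncl S)) = weight G p q ω := by
    intro ω
    simp only [W, preimage_map]
  have key := sum_lt_sum_mul_card hq h0 hlat hE (W := W)
    (fun O _ => weight_pos G hp0 hp1 hq0 _) (by
      intro O hO x y hxyE hxyO
      obtain ⟨ω, hω, rfl⟩ := subset_map_iff.1 hO
      obtain ⟨⟨hx, hx'⟩, ⟨hy, hy'⟩, hxy⟩ := (hEmem x y).1 hxyE
      have hmap : insert s(x, y) (ω.map (edgeIncl S)) =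
          (insert s((⟨x, hx⟩ : {x // x ∈ S}), (⟨y, hy⟩ : {x // x ∈ S})) ω).map (edgeIncl S) := by
        rw [map_insert, edgeIncl_mk]
      have hnot : s((⟨x, hx⟩ : {x // x ∈ S}), (⟨y, hy⟩ : {x // x ∈ S})) ∉ ω := fun h =>
        hxyO (by rw [← mem_map' (edgeIncl S)] at h; exact h)
      have hre := reachable_map_edgeIncl (ω := ω) (u := ⟨x, hx⟩) (v := ⟨y, hy⟩)
      simp only at hre
      rw [hmap, hWmap, hWmap, hre]
      exact ⟨weight_insert_of_reachable G hpq hxy hnot,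
        weight_insert_of_not_reachable G hq0.le hpq hxy hnot⟩)
  have hpow : ∀ F : Finset (Sym2 (ℤ × ℤ)) → ℝ,
      ∑ O ∈ E.powerset, F O = ∑ ω ∈ D.powerset, F (ω.map (edgeIncl S)) := by
    intro F
    refine (sum_nbij (fun ω : Finset (Sym2 {x // x ∈ S}) => ω.map (edgeIncl S)) ?_ ?_ ?_ fun _ _ => rfl).symm
    · intro ω hω
      exact mem_powerset.2 (map_subset_map.2 (mem_powerset.1 hω))
    · exact (map_injective _).injOn
    · intro O hO
      obtain ⟨ω, hω, rfl⟩ := subset_map_iff.1 (mem_powerset.1 (mem_coe.1 hO))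
      exact ⟨ω, mem_coe.2 (mem_powerset.2 hω), rfl⟩
  rw [hpow, hpow] at key
  simp only [hWmap] at key
  have hle : ∑ ω ∈ D.powerset, weight G p q ω * ((edgeBoundary S).filter fun e =>
      (SimpleGraph.fromEdgeSet ((ω.map (edgeIncl S) : Finset _) : Set (Sym2 (ℤ × ℤ)))).Reachable
        (0, 0) e.1).card ≤ phi p q S * ∑ ω ∈ D.powerset, weight G p q ω := by
    rw [phi, sum_mul]
    have h1 : ∀ ω : Finset (Sym2 {x // x ∈ S}),
        weight G p q ω * ((edgeBoundary S).filter fun e =>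
          (SimpleGraph.fromEdgeSet ((ω.map (edgeIncl S) : Finset _) : Set (Sym2 (ℤ × ℤ)))).Reachable
          (0, 0) e.1).card =
        ∑ e ∈ edgeBoundary S, if ω ∈ connected S (0, 0) e.1 then weight G p q ω else 0 := by
      intro ω
      rw [← sum_filter, sum_const, nsmul_eq_mul, mul_comm]
      congr 3
      refine filter_congr fun e he => ?_
      have hx : e.1 ∈ S := (mem_edgeBoundary.1 (show (e.1, e.2) ∈ edgeBoundary S from he)).2.1
      have := reachable_map_edgeIncl (ω := ω) (u := ⟨(0, 0), h0⟩) (v := ⟨e.1, hx⟩)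
      simp only at this
      rw [this]
      exact ⟨fun h => ⟨h0, hx, h⟩, fun ⟨_, _, h⟩ => h⟩
    rw [sum_congr rfl fun ω _ => h1 ω, sum_comm]
    refine sum_le_sum fun e _ => ?_
    rw [← sum_filter]
    refine sum_weight_le_freeProb_mul G hp0 hp1 hq.1 hD ?_
    rintro ω η hωη ⟨hu, hv, h⟩
    exact ⟨hu, hv, h.mono (SimpleGraph.fromEdgeSet_mono (coe_subset.2 hωη))⟩
  have hpos : 0 < ∑ ω ∈ D.powerset, weight G p q ω :=
    sum_pos (fun ω _ => weight_pos G hp0 hp1 hq0 ω) ⟨∅, by simp⟩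
  exact lt_of_mul_lt_mul_right (by linarith) hpos.le

end RandomCluster

theorem lemma3p2 (q : ℝ) (hq : q ∈ Set.Icc (1 : ℝ) 3) :
    ∃ C : ℝ, 0 < C ∧ ∀ n : ℕ, 1 ≤ n → ∀ S : Finset (ℤ × ℤ), (0, 0) ∈ S →
      S ⊆ RandomCluster.box n →
        C < RandomCluster.phi (RandomCluster.selfDualPoint q) q S :=
  ⟨1, one_pos, fun _ _ _ h0 _ => RandomCluster.one_lt_phi hq h0⟩
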